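/- Let $q$ be a prime power with $q\equiv 3\pmod 4$, and let $\delta\in\mathrm{GF}(q^4)$ be a primitive $2(q^2+1)$-th root of unity. For an integer $i$ let $g'_i(x)$ denote the minimal polynomial of $\delta^i$ over $\mathrm{GF}(q^2)$. Then $g'_1(x)\,g'_{q^2-q+1}(x)$ divides $x^{q^2+1}+1$. Let $\mathcal C=\mathcal C(1,q^2-q+1)$ be the negacyclic code of length $n=q^2+1$ over $\mathrm{GF}(q^2)$ with check polynomial $g'_1(x)\,g'_{q^2-q+1}(x)$, i.e. the set of all $(c_0,\dots,c_{n-1})\in\mathrm{GF}(q^2)^n$ such that $c_0+c_1x+\cdots+c_{n-1}x^{n-1}$ lies in the ideal of $\mathrm{GF}(q^2)[x]/(x^n+1)$ generated by $(x^n+1)/\bigl(g'_1(x)g'_{q^2-q+1}(x)\bigr)$. Let $\mathcal C^\perp$ be its dual with respect to the standard inner product. We say that the codewords of weight $w$ of a code of length $n$ support a $t$-$(n,w,\lambda)$ design, where $t,\lambda\ge 1$, if codewords of weight $w$ exist and every $t$-subset of the set of the $n$ coordinate positions is contained in exactly $\lambda$ of the distinct supports of the codewords of weight $w$. (i) The code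 $\mathcal C$ is negacyclic, has parameters $[q^2+1,4,q^2-q]$ and weight enumerator $$1+(q^5-q)z^{q^2-q}+\frac{(q^4-1)(q-1)q^3}{2}\left(z^{q^2-1}+z^{q^2+1}\right)+\left(q^7-q^5+q^4-q^3+q-1\right)z^{q^2}.$$ Furthermore, the minimum weight codewords of $\mathcal C$ support a $3$-$(q^2+1,\,q^2-q,\,\lambda)$ design with $$\lambda=(q^2-q-1)(q-2).$$ The complementary design of this design, whose blocks are the complements of its blocks, is a Steiner system $S(3,q+1,q^2+1)$, i.e. a $3$-$(q^2+1,q+1,1)$ design. (ii) The code $\mathcal C^\perp$ has parameters $[q^2+1,q^2-3,4]$, and the minimum weight codewords of $\mathcal C^\perp$ support a $3$-$(q^2+1,4,q-2)$ design. -/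

import Mathlib

open Polynomial

noncomputable section

namespace ConstacyclicCodes

variable {K : Type*} [Field K]

/-! ## Linear codes and their weights

A linear code of length `n` over `K` is a subspace of `Fin n → K`; the coordinates are indexed by
`0, 1, …, n - 1`. -/

/-- `C` is an `[n, k, d]` code: its dimension is `k`, and `d` is its minimum Hamming distance,
i.e. the least Hamming distance between two distinct codewords. -/
def HasParameters [DecidableEq K] {n : ℕ} (C : Submodule K (Fin n → K)) (k d : ℕ) : Prop :=
  Module.finrank K C = k ∧
    IsLeast {e : ℕ | ∃ x ∈ C, ∃ y ∈ C, x ≠ y ∧ hammingDist x y = e} d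

/-- The number `A_w` of codewords of Hamming weight `w` in `C`. -/
def weightCount [DecidableEq K] {n : ℕ} (C : Submodule K (Fin n → K)) (w : ℕ) : ℕ :=
  Set.ncard {c : Fin n → K | c ∈ C ∧ hammingNorm c = w}

/-- The weight enumerator `A_0 + A_1 z + A_2 z ^ 2 + ⋯ + A_n z ^ n` of `C`. -/
def weightEnumerator [DecidableEq K] {n : ℕ} (C : Submodule K (Fin n → K)) : ℚ[X] :=
  ∑ w ∈ Finset.range (n + 1), Polynomial.C (weightCount C w : ℚ) * X ^ w

/-- The dual code of `C` with respect to the standard inner product `∑ i, x i * y i`. -/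
def dualCode {n : ℕ} (C : Submodule K (Fin n → K)) : Submodule K (Fin n → K) where
  carrier := {y | ∀ x ∈ C, ∑ i, x i * y i = 0}
  zero_mem' := by intro x _; simp
  add_mem' := by
    intro a b ha hb x hx
    simp only [Pi.add_apply, mul_add, Finset.sum_add_distrib, ha x hx, hb x hx, add_zero]
  smul_mem' := by
    intro r a ha x hx
    have h : ∀ i, x i * (r • a) i = r * (x i * a i) := by
      intro i
      simp only [Pi.smul_apply, smul_eq_mul]
      ring
    simp only [h, ← Finset.mul_sum, ha x hx, mul_zero]

/-! ## Constacyclic codes -/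

/-- The map `(c_0, …, c_{n-1}) ↦ (lam * c_{n-1}, c_0, …, c_{n-2})`. -/
def constacyclicShift {n : ℕ} (lam : K) (c : Fin n → K) : Fin n → K := fun i =>
  if (i : ℕ) = 0 then lam * c ⟨n - 1, by have := i.isLt; omega⟩
  else c ⟨(i : ℕ) - 1, by have := i.isLt; omega⟩

/-- `C` is a `lam`-constacyclic code. -/
def IsConstacyclic {n : ℕ} (lam : K) (C : Submodule K (Fin n → K)) : Prop :=
  ∀ c ∈ C, constacyclicShift lam c ∈ C

/-- `C` is a negacyclic code. -/
def IsNegacyclic {n : ℕ} (C : Submodule K (Fin n → K)) : Prop :=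
  IsConstacyclic (-1) C

/-- The map `(c_0, …, c_{n-1}) ↦ c_0 + c_1 x + ⋯ + c_{n-1} x ^ (n - 1)` from `K ^ n` to
`K[x] / (x ^ n - lam)`. -/
def toQuotient (n : ℕ) (lam : K) :
    (Fin n → K) →ₗ[K] (K[X] ⧸ Ideal.span {(X ^ n - Polynomial.C lam : K[X])}) where
  toFun c := Ideal.Quotient.mk _ (∑ i : Fin n, Polynomial.C (c i) * X ^ (i : ℕ))
  map_add' a b := by
    simp only [Pi.add_apply, add_mul, Finset.sum_add_distrib, map_add]
  map_smul' r a := by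
    have h : (∑ i : Fin n, Polynomial.C ((r • a) i) * X ^ (i : ℕ) : K[X])
        = r • ∑ i : Fin n, Polynomial.C (a i) * X ^ (i : ℕ) := by
      simp only [Pi.smul_apply, smul_eq_mul, Polynomial.C_mul, Finset.smul_sum,
        Polynomial.smul_eq_C_mul, mul_assoc]
    rw [h]
    rfl

/-- The code of length `n` that corresponds to the ideal of `K[x] / (x ^ n - lam)` generated by
the class of `g`. It is used for the monic divisors `g` of `x ^ n - lam`; then it is the
`lam`-constacyclic code with generator polynomial `g`. -/
def codeOfGenerator (n : ℕ) (lam : K) (g : K[X]) : Submodule K (Fin n → K) :=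
  Submodule.comap (toQuotient n lam)
    (Submodule.restrictScalars K
      (Ideal.span {Ideal.Quotient.mk (Ideal.span {(X ^ n - Polynomial.C lam : K[X])}) g}))

/-- The `lam`-constacyclic code of length `n` with check polynomial `h`, where `h` is a monic
divisor of `x ^ n - lam`: its generator polynomial is `(x ^ n - lam) / h`. -/
def codeOfCheck (n : ℕ) (lam : K) (h : K[X]) : Submodule K (Fin n → K) :=
  codeOfGenerator n lam ((X ^ n - Polynomial.C lam) / h)

/-- For fields `K ⊆ L` with `q ^ 2` and `q ^ 4` elements and a primitive `2 * (q ^ 2 + 1)`-th root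
of unity `δ` in `L`: the product of the minimal polynomials over `K` of `δ` and of
`δ ^ (q ^ 2 - q + 1)`. -/
def checkPoly (q : ℕ) (K : Type*) [Field K] {L : Type*} [Field L] [Algebra K L] (δ : L) : K[X] :=
  minpoly K δ * minpoly K (δ ^ (q ^ 2 - q + 1))

/-- The negacyclic code `C(1, q ^ 2 - q + 1)` of length `q ^ 2 + 1`. -/
def negacyclicCode (q : ℕ) (K : Type*) [Field K] {L : Type*} [Field L] [Algebra K L] (δ : L) :
    Submodule K (Fin (q ^ 2 + 1) → K) :=
  codeOfCheck (q ^ 2 + 1) (-1) (checkPoly q K δ)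

/-! ## Designs -/

/-- `B` is the block set of a (simple) `t`-`(v, κ, lam)` design with point set `P`. -/
structure IsDesign {P : Type*} [Fintype P] (t v κ lam : ℕ) (B : Set (Finset P)) : Prop where
  card_points : Fintype.card P = v
  one_le : 1 ≤ κ
  le_card : κ ≤ v
  card_block : ∀ b ∈ B, b.card = κ
  card_containing : ∀ T : Finset P, T.card = t → Set.ncard {b | b ∈ B ∧ T ⊆ b} = lam

/-- `B` is the block set of a Steiner system `S(t, κ, v)`. -/
def IsSteinerSystem {P : Type*} [Fintype P] (t κ v : ℕ) (B : Set (Finset P)) : Prop :=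
  2 ≤ t ∧ IsDesign t v κ 1 B

/-- The block set of the complementary design: the complements of the blocks. -/
def complementBlocks {P : Type*} [Fintype P] [DecidableEq P] (B : Set (Finset P)) :
    Set (Finset P) :=
  {b | ∃ a ∈ B, b = aᶜ}

/-- The support of a vector. -/
def support [DecidableEq K] {n : ℕ} (c : Fin n → K) : Finset (Fin n) :=
  Finset.univ.filter fun i => c i ≠ 0

/-- The set of the supports of all codewords of Hamming weight `w` in `C`. -/
def supportBlocks [DecidableEq K] {n : ℕ} (C : Submodule K (Fin n → K)) (w : ℕ) :
    Set (Finset (Fin n)) :=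
  {b | ∃ c ∈ C, hammingNorm c = w ∧ b = support c}

/-- The codewords of weight `w` in `C` support a `t`-`(n, w, lam)` design. -/
def SupportsDesign [DecidableEq K] {n : ℕ} (C : Submodule K (Fin n → K)) (t w lam : ℕ) : Prop :=
  1 ≤ t ∧ 1 ≤ lam ∧ weightCount C w ≠ 0 ∧ IsDesign t n w lam (supportBlocks C w)

end ConstacyclicCodes

end

/-! The code is the code of the Miquelian inversive plane. Put `x i = δ⁻¹ ^ i` and `z i = x i ^ (q -
1)`. Since `q ≡ 3 [MOD 4]`, the `z i` are exactly the `q ^ 2 + 1` distinct roots of unity of that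
order. On them `y ↦ y ^ q ^ 2` is inversion, which preserves cross ratios, so all cross ratios of
these points lie in `K` or are infinite. Circles are the sets on which the cross ratio with three
fixed points lies in the field with `q` elements or is infinite; they have `q + 1` points
(`card_circle`).

The equation of a circle is a combination of `1, z d, z d ^ q, z d ^ (q + 1)`. Multiplied by `x d`,
these become powers of the inverses of `δ, δ ^ q, δ ^ (q ^ 2 - q + 1), δ ^ q ^ 2`, which are roots
of the check polynomial. After scaling the values lie in `K`, so every circle is the zero set of a
codeword (`exists_circle_word`).

Everything else follows from `IsCircleCode`. Any three positions impose independent conditions on a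
code of dimension four, so words with three common zeros are proportional. Hence a nonzero word has
0, 1, 2 or `q + 1` zeros, and three zeros lie on exactly one circle. Four moment equations then give
the weights. Inclusion-exclusion in the inversive plane gives the design of supports. In the dual
code, the supports of weight four are the 4-subsets of circles. -/

noncomputable section

namespace ConstacyclicCodes

/-! ## Constacyclic codes given by a check polynomial -/

section Check

variable {K : Type*} [Field K]

/-- The polynomial `c_0 + c_1 x + ⋯ + c_{n-1} x ^ (n - 1)`. -/
def wordPoly {n : ℕ} (c : Fin n → K) : K[X] := ∑ i : Fin n, C (c i) * X ^ (i : ℕ)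

lemma coeff_wordPoly {n : ℕ} (c : Fin n → K) (j : Fin n) : (wordPoly c).coeff j = c j := by
  simp [wordPoly, coeff_C_mul, coeff_X_pow, Fin.val_inj]

lemma wordPoly_coeff_of_le {n : ℕ} (c : Fin n → K) {m : ℕ} (hm : n ≤ m) :
    (wordPoly c).coeff m = 0 := by
  simp only [wordPoly, finsetSum_coeff, coeff_C_mul, coeff_X_pow]
  refine Finset.sum_eq_zero fun i _ => ?_
  have := i.isLt
  rw [if_neg (by omega), mul_zero]

/-- The generator `g` divides `X ^ n - lam`, so divisibility by `g` can be tested before passing to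
the quotient. Multiplying by `h` then removes polynomial division from all later arguments. -/
lemma mem_codeOfCheck_iff {n : ℕ} {lam : K} (hn : n ≠ 0) {h : K[X]}
    (hh : h ∣ X ^ n - C lam) (c : Fin n → K) :
    c ∈ codeOfCheck n lam h ↔ X ^ n - C lam ∣ h * wordPoly c := by
  have hF : (X ^ n - C lam : K[X]) ≠ 0 := X_pow_sub_C_ne_zero (Nat.pos_of_ne_zero hn) lam
  obtain ⟨g, hg⟩ := hh
  have h0 : h ≠ 0 := by rintro rfl; simp [hg] at hF
  have hdiv : (X ^ n - C lam) / h = g := by rw [hg, mul_div_cancel_left₀ _ h0]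
  have key : c ∈ codeOfCheck n lam h ↔ g ∣ wordPoly c := by
    unfold codeOfCheck codeOfGenerator
    rw [hdiv, Submodule.mem_comap, Submodule.restrictScalars_mem, Ideal.mem_span_singleton]
    change (Ideal.Quotient.mk _ g) ∣ (Ideal.Quotient.mk _ (wordPoly c)) ↔ _
    constructor
    · rintro ⟨u, hu⟩
      obtain ⟨u, rfl⟩ := Ideal.Quotient.mk_surjective u
      rw [← map_mul, Ideal.Quotient.eq, Ideal.mem_span_singleton] at hu
      have h1 : g ∣ wordPoly c - g * u := (Dvd.intro_left h hg.symm).trans hu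
      have := dvd_add h1 (dvd_mul_right g u)
      simpa using this
    · rintro ⟨u, hu⟩
      exact ⟨Ideal.Quotient.mk _ u, by rw [hu, map_mul]⟩
  rw [key, hg, mul_dvd_mul_iff_left h0]

/-- Multiplication by `X` creates one term of degree `n`; subtracting a multiple of `X ^ n - lam`
wraps it round to the constant term. -/
lemma wordPoly_constacyclicShift {n : ℕ} (hn : n ≠ 0) (lam : K) (c : Fin n → K) :
    wordPoly (constacyclicShift lam c) =
      X * wordPoly c - C (c ⟨n - 1, by omega⟩) * (X ^ n - C lam) := by
  obtain ⟨m, rfl⟩ := Nat.exists_eq_succ_of_ne_zero hn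
  unfold wordPoly
  rw [Fin.sum_univ_succ, Fin.sum_univ_castSucc]
  have h1 : ∀ i : Fin m, constacyclicShift lam c i.succ = c i.castSucc := by
    intro i; simp only [constacyclicShift, Fin.val_succ]
    rw [if_neg (by omega)]; rfl
  have h2 : constacyclicShift lam c 0 = lam * c (Fin.last m) := by
    simp only [constacyclicShift]; rfl
  have h3 : (⟨m + 1 - 1, by omega⟩ : Fin (m + 1)) = Fin.last m := rfl
  simp only [h1, h2, Nat.succ_eq_add_one, h3, Fin.val_succ, Fin.val_castSucc, Fin.val_last,
    Fin.val_zero, mul_add, Finset.mul_sum, C_mul]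
  have h4 : ∀ i : Fin m, (C (c i.castSucc) * X ^ ((i : ℕ) + 1) : K[X])
      = X * (C (c i.castSucc) * X ^ (i : ℕ)) := fun i => by ring
  simp only [h4]
  ring

lemma isConstacyclic_codeOfCheck {n : ℕ} {lam : K} (hn : n ≠ 0) {h : K[X]}
    (hh : h ∣ X ^ n - C lam) : IsConstacyclic lam (codeOfCheck n lam h) := by
  intro c hc
  rw [mem_codeOfCheck_iff hn hh] at hc ⊢
  rw [wordPoly_constacyclicShift hn, mul_sub]
  refine dvd_sub ?_ ?_
  · rw [mul_left_comm]; exact hc.mul_left X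
  · rw [← mul_assoc]; exact dvd_mul_left _ _

/-- A code is at most as large as the degree of a check polynomial. -/
lemma finrank_codeOfCheck_le {n : ℕ} {lam : K} (hn : n ≠ 0) {h : K[X]}
    (hh : h ∣ X ^ n - C lam) {d : ℕ} (hd : h.natDegree ≤ d) (hdn : d ≤ n) :
    Module.finrank K (codeOfCheck n lam h) ≤ d := by
  -- Projection to the last `d` positions. A codeword in its kernel has degree below `n - d`, so its
  -- product with `h` has degree below `n`, yet is a multiple of `X ^ n - lam`.
  let f : (Fin n → K) →ₗ[K] (Fin d → K) :=
    LinearMap.funLeft K K fun i : Fin d => (⟨n - d + i, by omega⟩ : Fin n)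
  have hinj : Function.Injective (f.comp (codeOfCheck n lam h).subtype) := by
    rw [← LinearMap.ker_eq_bot, LinearMap.ker_eq_bot']
    rintro ⟨c, hc⟩ h0
    rw [mem_codeOfCheck_iff hn hh] at hc
    have hF : (X ^ n - C lam : K[X]) ≠ 0 := X_pow_sub_C_ne_zero (Nat.pos_of_ne_zero hn) lam
    have hh0 : h ≠ 0 := by rintro rfl; exact hF (zero_dvd_iff.mp hh)
    have hw : wordPoly c = 0 := by
      by_contra hne
      have hdeg : (wordPoly c).natDegree < n - d := by
        rw [natDegree_lt_iff_degree_lt hne, degree_lt_iff_coeff_zero]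
        intro m hm
        by_cases hmn : n ≤ m
        · exact wordPoly_coeff_of_le c hmn
        · have h1 := congrFun h0 ⟨m - (n - d), by omega⟩
          have h2 : c ⟨n - d + (m - (n - d)), by omega⟩ = 0 := h1
          have h3 := coeff_wordPoly c ⟨n - d + (m - (n - d)), by omega⟩
          rw [h2] at h3
          rw [← h3]
          congr 1
          simp only
          omega
      have h1 := natDegree_le_of_dvd hc (mul_ne_zero hh0 hne)
      rw [natDegree_mul hh0 hne, natDegree_X_pow_sub_C] at h1
      omega
    ext j
    change c j = 0
    rw [← coeff_wordPoly c j, hw]; rfl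
  have := LinearMap.finrank_le_finrank_of_injective hinj
  simpa using this

/-- A word that is a combination of geometric progressions in inverses of roots of the check
polynomial is a codeword. -/
lemma mem_codeOfCheck_of_eq_sum {L : Type*} [Field L] [Algebra K L] {n : ℕ} {lam : K} (hn : n ≠ 0)
    {h : K[X]} (hh : h ∣ X ^ n - C lam) {ι : Type*} (s : Finset ι) (a y : ι → L)
    (hy : ∀ k ∈ s, y k ≠ 0 ∧ aeval (y k)⁻¹ h = 0) (c : Fin n → K)
    (hc : ∀ i, algebraMap K L (c i) = ∑ k ∈ s, a k * y k ^ (i : ℕ)) :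
    c ∈ codeOfCheck n lam h := by
  rw [mem_codeOfCheck_iff hn hh, ← map_dvd_map' (algebraMap K L), Polynomial.map_mul]
  have hw : (wordPoly c).map (algebraMap K L) =
      ∑ k ∈ s, C (a k) * ∑ i ∈ Finset.range n, (C (y k) * X) ^ i := by
    simp only [wordPoly, Polynomial.map_sum, Polynomial.map_mul, map_C, Polynomial.map_pow, map_X,
      hc, ← Fin.sum_univ_eq_sum_range, Finset.mul_sum]
    rw [Finset.sum_comm]
    refine Finset.sum_congr rfl fun i _ => ?_
    rw [map_sum, Finset.sum_mul]
    refine Finset.sum_congr rfl fun k _ => ?_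
    rw [C_mul, C_pow]; ring
  rw [hw, Finset.mul_sum]
  refine Finset.dvd_sum fun k hk => ?_
  obtain ⟨h0, hroot⟩ := hy k hk
  have h1 : (C (y k) * X - 1) ∣ h.map (algebraMap K L) := by
    have : (X - C (y k)⁻¹) ∣ h.map (algebraMap K L) := by
      rw [dvd_iff_isRoot, IsRoot, eval_map_algebraMap, hroot]
    obtain ⟨u, hu⟩ := this
    refine ⟨C (y k)⁻¹ * u, ?_⟩
    rw [hu]
    have h2 : (C (y k) * C (y k)⁻¹ : L[X]) = 1 := by rw [← C_mul, mul_inv_cancel₀ h0, C_1]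
    linear_combination (-X * u) * h2
  have hpow : y k ^ n * algebraMap K L lam = 1 := by
    have : aeval (y k)⁻¹ (X ^ n - C lam : K[X]) = 0 := by
      obtain ⟨u, hu⟩ := hh
      rw [hu, map_mul, hroot, zero_mul]
    simp only [map_sub, map_pow, aeval_X, aeval_C, sub_eq_zero] at this
    rw [← this, ← mul_pow, mul_inv_cancel₀ h0, one_pow]
  obtain ⟨u, hu⟩ := h1
  rw [hu]
  -- The geometric sum times `y X - 1` is `(y X) ^ n - 1 = y ^ n * (X ^ n - lam)`, because `y ^ n *
  -- lam = 1`; and `h` is a multiple of `y X - 1`.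
  have h3 := geom_sum_mul (C (y k) * X : L[X]) n
  refine ⟨C (y k ^ n) * u * C (a k), ?_⟩
  have h4 : (C (y k ^ n) * C (algebraMap K L lam) : L[X]) = 1 := by rw [← C_mul, hpow, C_1]
  simp only [Polynomial.map_sub, Polynomial.map_pow, map_X, map_C]
  rw [mul_pow, ← C_pow] at h3
  linear_combination (u * C (a k)) * h3 + (u * C (a k)) * h4

end Check

/-! ## Finite fields -/

/-- The image of `K` already supplies as many roots of `X ^ |K| - X` as its degree allows. -/
lemma exists_algebraMap_eq_of_pow_card {K L : Type*} [Field K] [Finite K] [Field L] [Algebra K L]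
    {y : L} (hy : y ^ Nat.card K = y) : ∃ k : K, algebraMap K L k = y := by
  classical
  have := Fintype.ofFinite K
  rw [Nat.card_eq_fintype_card] at hy
  have h1 : 1 < Fintype.card K := Fintype.one_lt_card
  have hne := FiniteField.X_pow_card_sub_X_ne_zero L h1
  have hsub : (Finset.univ.image (algebraMap K L)) ⊆
      (X ^ Fintype.card K - X : L[X]).roots.toFinset := by
    intro x hx
    obtain ⟨k, -, rfl⟩ := Finset.mem_image.mp hx
    simp [hne, ← map_pow, FiniteField.pow_card]
  have hcard : (X ^ Fintype.card K - X : L[X]).roots.toFinset.card ≤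
      (Finset.univ.image (algebraMap K L)).card := by
    rw [Finset.card_image_of_injective _ (algebraMap K L).injective, Finset.card_univ]
    refine (Multiset.toFinset_card_le _).trans ((card_roots' _).trans ?_)
    rw [FiniteField.X_pow_card_sub_X_natDegree_eq L h1]
  have hmem : y ∈ (X ^ Fintype.card K - X : L[X]).roots.toFinset := by simp [hne, hy]
  rw [← Finset.eq_of_subset_of_card_le hsub hcard] at hmem
  obtain ⟨k, -, hk⟩ := Finset.mem_image.mp hmem
  exact ⟨k, hk⟩

/-- The subfield of order `q` of a field with `q ^ 2` elements. -/
lemma card_filter_pow_eq_self {K : Type*} [Field K] [Fintype K] [DecidableEq K] {q : ℕ}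
    (hq : 2 ≤ q) (hK : Fintype.card K = q ^ 2) :
    (Finset.univ.filter fun k : K => k ^ q = k).card = q := by
  obtain ⟨g, hg⟩ := IsCyclic.exists_ofOrder_eq_natCard (α := Kˣ)
  rw [Nat.card_units, Nat.card_eq_fintype_card, hK] at hg
  have hfac : q ^ 2 - 1 = (q + 1) * (q - 1) := by
    simpa using Nat.sq_sub_sq q 1
  -- The nonzero solutions of `k ^ q = k` are the `(q - 1)`-th roots of unity, and `g ^ (q + 1)` has
  -- order `q - 1`.
  have hprim : IsPrimitiveRoot (g : K) (q ^ 2 - 1) :=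
    (IsPrimitiveRoot.coe_units_iff).mpr (hg ▸ IsPrimitiveRoot.orderOf g)
  have hz : IsPrimitiveRoot ((g : K) ^ (q + 1)) (q - 1) :=
    hprim.pow (by rw [hfac]; exact Nat.mul_pos (by omega) (by omega)) hfac
  have hset : (Finset.univ.filter fun k : K => k ^ q = k) =
      insert 0 (nthRootsFinset (q - 1) (1 : K)) := by
    ext k
    simp only [Finset.mem_filter, Finset.mem_univ, true_and, Finset.mem_insert,
      mem_nthRootsFinset (show 0 < q - 1 by omega)]
    by_cases hk : k = 0
    · simp [hk, show q ≠ 0 by omega]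
    · have : k ^ q = k ^ (q - 1) * k := by rw [← pow_succ]; congr 1; omega
      rw [this]
      simp [hk]
  rw [hset, Finset.card_insert_of_notMem, hz.card_nthRootsFinset]
  · omega
  · rw [mem_nthRootsFinset (show 0 < q - 1 by omega), zero_pow (by omega)]
    exact zero_ne_one

/-! ## Circles on the set of norm one elements

For points `z i` with `z i ^ (q ^ 2 + 1) = 1`, the circle through `z a`, `z b`, `z c` consists of
the `z d` for which the cross ratio `circleNum / circleDen` lies in the field with `q` elements or
is infinite. -/

section Circle

variable {K L : Type*} [Field K] [Field L] [Algebra K L] {ι : Type*}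

/-- The numerator of the cross ratio of four points. -/
def circleNum (z : ι → L) (a b c d : ι) : L := (z c - z b) * (z d - z a)

/-- The denominator of the cross ratio of four points. -/
def circleDen (z : ι → L) (a b c d : ι) : L := (z c - z a) * (z d - z b)

/-- A form in `z d` which vanishes on the circle through `z a`, `z b`, `z c`. -/
def circleForm (q : ℕ) (z : ι → L) (a b c d : ι) : L :=
  circleNum z a b c d ^ q * circleDen z a b c d - circleNum z a b c d * circleDen z a b c d ^ q

/-- Exchanging `c` and `d` exchanges the numerator and the denominator of the cross ratio. -/
lemma circleForm_swap (q : ℕ) (z : ι → L) (a b c d : ι) :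
    circleForm q z a b d c = - circleForm q z a b c d := by
  unfold circleForm circleNum circleDen
  rw [mul_comm (z d - z b), mul_comm (z d - z a)]
  ring

variable {q : ℕ} {z : ι → L}

lemma sub_pow_sq (hsub : ∀ y w : L, (y - w) ^ q = y ^ q - w ^ q) (y w : L) :
    (y - w) ^ q ^ 2 = y ^ q ^ 2 - w ^ q ^ 2 := by
  rw [sq, pow_mul, hsub, hsub, ← pow_mul, ← pow_mul]

lemma sub_pow_sq_mul (hsub : ∀ y w : L, (y - w) ^ q = y ^ q - w ^ q)
    (hz : ∀ i, z i ^ q ^ 2 * z i = 1) (i j : ι) :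
    (z i - z j) ^ q ^ 2 * (z i * z j) = z j - z i := by
  rw [sub_pow_sq hsub]
  linear_combination (z j) * hz i - z i * hz j

/-- Here `z ^ q ^ 2` is `z⁻¹`. Numerator and denominator acquire the same factor, so the cross ratio
is fixed by the Frobenius map of `K`. -/
lemma circleNum_pow (hsub : ∀ y w : L, (y - w) ^ q = y ^ q - w ^ q)
    (hz : ∀ i, z i ^ q ^ 2 * z i = 1) (a b c d : ι) :
    circleNum z a b c d ^ q ^ 2 * (z a * z b * z c * z d) = circleNum z a b c d := by
  unfold circleNum
  have h1 := sub_pow_sq_mul hsub hz c b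
  have h2 := sub_pow_sq_mul hsub hz d a
  calc _ = ((z c - z b) ^ q ^ 2 * (z c * z b)) * ((z d - z a) ^ q ^ 2 * (z d * z a)) := by
        rw [mul_pow]; ring
    _ = _ := by rw [h1, h2]; ring

lemma circleDen_pow (hsub : ∀ y w : L, (y - w) ^ q = y ^ q - w ^ q)
    (hz : ∀ i, z i ^ q ^ 2 * z i = 1) (a b c d : ι) :
    circleDen z a b c d ^ q ^ 2 * (z a * z b * z c * z d) = circleDen z a b c d := by
  have := circleNum_pow hsub hz b a c d
  unfold circleNum at this
  unfold circleDen
  rw [mul_comm (z a) (z b)]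
  exact this

lemma circleForm_pow (hsub : ∀ y w : L, (y - w) ^ q = y ^ q - w ^ q)
    (hz : ∀ i, z i ^ q ^ 2 * z i = 1) (a b c d : ι) :
    circleForm q z a b c d ^ q ^ 2 * (z a * z b * z c * z d) ^ (q + 1) =
      circleForm q z a b c d := by
  have h1 := circleNum_pow hsub hz a b c d
  have h2 := circleDen_pow hsub hz a b c d
  unfold circleForm
  set u := circleNum z a b c d
  set v := circleDen z a b c d
  set P := z a * z b * z c * z d
  rw [sub_pow_sq hsub]
  calc _ = (u ^ q ^ 2 * P) ^ q * (v ^ q ^ 2 * P) - (u ^ q ^ 2 * P) * (v ^ q ^ 2 * P) ^ q := by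
        simp only [mul_pow, ← pow_mul, mul_comm q (q ^ 2)]; ring
    _ = _ := by rw [h1, h2]

/-- The circle through three points has `q + 1` points. -/
lemma card_circle [Fintype K] [Fintype ι] [DecidableEq L] (hq : 2 ≤ q) (hK : Fintype.card K = q ^ 2)
    (hι : Fintype.card ι = q ^ 2 + 1) (hsub : ∀ y w : L, (y - w) ^ q = y ^ q - w ^ q)
    (hz : ∀ i, z i ^ q ^ 2 * z i = 1) (hinj : Function.Injective z) {a b c : ι}
    (hab : a ≠ b) (hac : a ≠ c) (hbc : b ≠ c) :
    (Finset.univ.filter fun d => circleForm q z a b c d = 0).card = q + 1 := by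
  classical
  have hz0 : ∀ i, z i ≠ 0 := fun i h => by simpa [h] using hz i
  have hne : ∀ {i j}, i ≠ j → z i - z j ≠ 0 := fun h => sub_ne_zero.mpr (hinj.ne h)
  have hden : ∀ d, d ≠ b → circleDen z a b c d ≠ 0 := fun d hd =>
    mul_ne_zero (hne hac.symm) (hne hd)
  have hfix : ∀ d, ∃ k : K, algebraMap K L k = circleNum z a b c d / circleDen z a b c d := by
    intro d
    apply exists_algebraMap_eq_of_pow_card
    rw [Nat.card_eq_fintype_card, hK, div_pow]
    have hP : z a * z b * z c * z d ≠ 0 :=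
      mul_ne_zero (mul_ne_zero (mul_ne_zero (hz0 a) (hz0 b)) (hz0 c)) (hz0 d)
    rw [← mul_div_mul_right _ _ hP, circleNum_pow hsub hz, circleDen_pow hsub hz]
  choose t ht using hfix
  -- The cross ratio is a Möbius function of `z d`, hence injective. With `q ^ 2` positions besides
  -- `b`, it takes every value in `K` once.
  have htinj : Function.Injective fun d : {d // d ≠ b} => t d := by
    rintro ⟨d, hd⟩ ⟨e, he⟩ h
    have h1 : circleNum z a b c d / circleDen z a b c d =
        circleNum z a b c e / circleDen z a b c e := by rw [← ht, ← ht]; exact congrArg _ h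
    rw [div_eq_div_iff (hden d hd) (hden e he)] at h1
    unfold circleNum circleDen at h1
    have h2 : (z c - z b) * (z c - z a) * (z a - z b) * (z d - z e) = 0 := by
      linear_combination h1
    have h3 := (mul_eq_zero.mp h2).resolve_left
      (mul_ne_zero (mul_ne_zero (hne hbc.symm) (hne hac.symm)) (hne hab))
    exact Subtype.ext (hinj (sub_eq_zero.mp h3))
  have htbij : Function.Bijective fun d : {d // d ≠ b} => t d := by
    rw [Fintype.bijective_iff_injective_and_card]
    refine ⟨htinj, ?_⟩
    rw [hK, Fintype.card_subtype_compl, hι]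
    simp
  have hzero : ∀ d, d ≠ b → (circleForm q z a b c d = 0 ↔ t d ^ q = t d) := by
    intro d hd
    rw [← (algebraMap K L).injective.eq_iff, map_pow, ht, div_pow,
      div_eq_div_iff (pow_ne_zero _ (hden d hd)) (hden d hd)]
    unfold circleForm
    rw [sub_eq_zero]
  -- The position `b`, where the cross ratio is infinite, is added to the `q` finite values.
  have hset : (Finset.univ.filter fun d => circleForm q z a b c d = 0) =
      insert b (Finset.univ.filter fun d => d ≠ b ∧ t d ^ q = t d) := by
    ext d
    simp only [Finset.mem_filter, Finset.mem_univ, true_and, Finset.mem_insert]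
    by_cases hd : d = b
    · subst hd
      simp [circleForm, circleDen, show q ≠ 0 by omega]
    · rw [hzero d hd]; simp [hd]
  rw [hset, Finset.card_insert_of_notMem (by simp)]
  congr 1
  refine Eq.trans ?_ (card_filter_pow_eq_self hq hK)
  refine Finset.card_bij (fun d _ => t d) ?_ ?_ ?_
  · intro d hd; simpa using (Finset.mem_filter.mp hd).2.2
  · intro d hd e he h
    exact congrArg Subtype.val
      (@htinj ⟨d, (Finset.mem_filter.mp hd).2.1⟩ ⟨e, (Finset.mem_filter.mp he).2.1⟩ h)
  · intro k hk
    obtain ⟨⟨d, hd⟩, rfl⟩ := htbij.2 k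
    exact ⟨d, by simpa [hd] using hk, rfl⟩

end Circle

/-! ## The code `C(1, q ^ 2 - q + 1)` and its circle words -/

lemma aeval_pow_card_eq_zero {K L : Type*} [Field K] [Finite K] [Field L] [Algebra K L]
    {p : K[X]} {y : L} (h : aeval y p = 0) : aeval (y ^ Nat.card K) p = 0 := by
  have := Fintype.ofFinite K
  rw [Nat.card_eq_fintype_card]
  have := aeval_algHom_apply (FiniteField.frobeniusAlgHom K L) y p
  rw [h, map_zero] at this
  exact this

section Code

variable {q : ℕ} {K L : Type*} [Field K] [Field L] [Algebra K L] {δ : L}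

/-- The two uses of `q ≡ 3 [MOD 4]`: `q - 1` is twice an odd number, so that the `z i` are distinct;
and `q ^ 2 - q + 1` is odd, so that this power of `δ` is again a root of `X ^ (q ^ 2 + 1) + 1`. -/
lemma exponent_identities (hq3 : 3 ≤ q) (hq4 : q % 4 = 3) :
    ∃ m, q = 4 * m + 3 ∧ q - 1 = 2 * (2 * m + 1) ∧
      q ^ 2 - q + 1 = 2 * ((4 * m + 3) * (2 * m + 1)) + 1 := by
  refine ⟨q / 4, by omega, by omega, ?_⟩
  obtain ⟨m, rfl⟩ : ∃ m, q = 4 * m + 3 := ⟨q / 4, by omega⟩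
  have : (4 * m + 3) / 4 = m := by omega
  rw [this]
  have h : (4 * m + 3) ^ 2 = 2 * ((4 * m + 3) * (2 * m + 1)) + (4 * m + 3) := by ring
  omega

lemma finrank_eq_two (hq3 : 3 ≤ q) (hK : Nat.card K = q ^ 2) (hL : Nat.card L = q ^ 4) :
    Module.finrank K L = 2 := by
  have : Finite K := Nat.finite_of_card_ne_zero (by rw [hK]; positivity)
  have : Finite L := Nat.finite_of_card_ne_zero (by rw [hL]; positivity)
  have h := Module.natCard_eq_pow_finrank (K := K) (V := L)
  rw [hK, hL, ← pow_mul] at h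
  have := Nat.pow_right_injective (show 2 ≤ q by omega) h
  omega

lemma pow_eq_neg_one (hδ : IsPrimitiveRoot δ (2 * (q ^ 2 + 1))) : δ ^ (q ^ 2 + 1) = -1 :=
  IsPrimitiveRoot.eq_neg_one_of_two_right (hδ.pow (by positivity) (mul_comm _ _))

lemma checkPoly_dvd (hq3 : 3 ≤ q) (hq4 : q % 4 = 3) (hK : Nat.card K = q ^ 2)
    (hL : Nat.card L = q ^ 4) (hδ : IsPrimitiveRoot δ (2 * (q ^ 2 + 1))) :
    checkPoly q K δ ∣ X ^ (q ^ 2 + 1) - C (-1 : K) := by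
  have : Finite K := Nat.finite_of_card_ne_zero (by rw [hK]; positivity)
  have hfr := finrank_eq_two hq3 hK hL
  have : FiniteDimensional K L := Module.finite_of_finrank_eq_succ hfr
  have hn := pow_eq_neg_one hδ
  obtain ⟨m, hm, -, he⟩ := exponent_identities hq3 hq4
  have hint : ∀ y : L, IsIntegral K y := fun y => Algebra.IsIntegral.isIntegral y
  refine IsCoprime.mul_dvd ?_ ?_ ?_
  -- If the two minimal polynomials had a common factor, the second, of degree at most two, would
  -- have the three roots `δ`, `δ ^ q ^ 2` and `δ ^ (q ^ 2 - q + 1)`.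
  · refine (EuclideanDomain.dvd_or_coprime _ _ (minpoly.irreducible (hint δ))).resolve_left ?_
    intro hdvd
    set p := minpoly K (δ ^ (q ^ 2 - q + 1))
    have hp0 : p ≠ 0 := minpoly.ne_zero (hint _)
    have h1 : aeval δ p = 0 := by
      obtain ⟨u, hu⟩ := hdvd
      rw [hu, map_mul, minpoly.aeval, zero_mul]
    have h2 := aeval_pow_card_eq_zero h1
    rw [hK] at h2
    have h3 : aeval (δ ^ (q ^ 2 - q + 1)) p = 0 := minpoly.aeval _ _
    have hqq : q * 3 ≤ q ^ 2 := by rw [sq]; exact Nat.mul_le_mul_left q hq3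
    have hd1 : δ ≠ δ ^ q ^ 2 := by
      intro h
      have := hδ.pow_inj (by omega) (by omega) ((pow_one δ).trans h)
      omega
    have hd2 : δ ≠ δ ^ (q ^ 2 - q + 1) := by
      intro h
      have := hδ.pow_inj (by omega) (by omega) ((pow_one δ).trans h)
      omega
    have hd3 : δ ^ q ^ 2 ≠ δ ^ (q ^ 2 - q + 1) := by
      intro h
      have := hδ.pow_inj (by omega) (by omega) h
      omega
    classical
    have hroots : ({δ, δ ^ q ^ 2, δ ^ (q ^ 2 - q + 1)} : Finset L).val ⊆
        (p.map (algebraMap K L)).roots := by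
      intro y hy
      rw [mem_roots ((Polynomial.map_ne_zero_iff (algebraMap K L).injective).mpr hp0), IsRoot,
        eval_map_algebraMap]
      simp only [Finset.mem_val, Finset.mem_insert, Finset.mem_singleton] at hy
      rcases hy with rfl | rfl | rfl <;> assumption
    have h4 := Polynomial.card_le_degree_of_subset_roots hroots
    rw [Finset.card_eq_three.mpr ⟨_, _, _, hd1, hd2, hd3, rfl⟩, natDegree_map] at h4
    have h5 : p.natDegree ≤ 2 := hfr ▸ minpoly.natDegree_le _
    omega
  · apply minpoly.dvd
    simp [hn]
  · apply minpoly.dvd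
    have : (δ ^ (q ^ 2 - q + 1)) ^ (q ^ 2 + 1) = -1 := by
      rw [← pow_mul, mul_comm, pow_mul, hn, he, pow_succ, pow_mul]; simp
    simp [this]

lemma natDegree_checkPoly_le (hq3 : 3 ≤ q) (hK : Nat.card K = q ^ 2)
    (hL : Nat.card L = q ^ 4) : (checkPoly q K δ).natDegree ≤ 4 := by
  have hfr := finrank_eq_two hq3 hK hL
  have : FiniteDimensional K L := Module.finite_of_finrank_eq_succ hfr
  refine natDegree_mul_le.trans ?_
  have h1 : (minpoly K δ).natDegree ≤ 2 := hfr ▸ minpoly.natDegree_le _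
  have h2 : (minpoly K (δ ^ (q ^ 2 - q + 1))).natDegree ≤ 2 := hfr ▸ minpoly.natDegree_le _
  omega

lemma aeval_checkPoly (hq3 : 3 ≤ q) (hq4 : q % 4 = 3) (hK : Nat.card K = q ^ 2)
    (hδ : IsPrimitiveRoot δ (2 * (q ^ 2 + 1))) :
    aeval δ (checkPoly q K δ) = 0 ∧ aeval (δ ^ q) (checkPoly q K δ) = 0 ∧
    aeval (δ ^ (q ^ 2 - q + 1)) (checkPoly q K δ) = 0 ∧
    aeval (δ ^ q ^ 2) (checkPoly q K δ) = 0 := by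
  have : Finite K := Nat.finite_of_card_ne_zero (by rw [hK]; positivity)
  have h1 : aeval δ (checkPoly q K δ) = 0 := by simp [checkPoly]
  have h2 : aeval (δ ^ (q ^ 2 - q + 1)) (checkPoly q K δ) = 0 := by simp [checkPoly]
  have h3 := aeval_pow_card_eq_zero h1
  have h4 := aeval_pow_card_eq_zero h2
  rw [hK] at h3 h4
  refine ⟨h1, ?_, h2, h3⟩
  obtain ⟨m, hm, -, he⟩ := exponent_identities hq3 hq4
  -- This is `(q ^ 2 + 1) * (q ^ 2 - q) + q` with the even number `q ^ 2 - q` halved; so `δ ^ q` is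
  -- the conjugate of `δ ^ (q ^ 2 - q + 1)`.
  have hexp : (q ^ 2 - q + 1) * q ^ 2 =
      2 * (q ^ 2 + 1) * ((4 * m + 3) * (2 * m + 1)) + q := by
    rw [he, hm]; ring
  have : (δ ^ (q ^ 2 - q + 1)) ^ q ^ 2 = δ ^ q := by
    rw [← pow_mul, hexp, pow_add, pow_mul, hδ.pow_eq_one, one_pow, one_mul]
  rwa [this] at h4

lemma exists_circle_word (hq3 : 3 ≤ q) (hq4 : q % 4 = 3) (hK : Nat.card K = q ^ 2)
    (hL : Nat.card L = q ^ 4) (hδ : IsPrimitiveRoot δ (2 * (q ^ 2 + 1)))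
    (hsub : ∀ y w : L, (y - w) ^ q = y ^ q - w ^ q)
    (hz : ∀ i : Fin (q ^ 2 + 1), (((δ⁻¹) ^ (i : ℕ)) ^ (q - 1)) ^ q ^ 2 *
      ((δ⁻¹) ^ (i : ℕ)) ^ (q - 1) = 1)
    (a b c : Fin (q ^ 2 + 1)) :
    ∃ w ∈ negacyclicCode q K δ, ∀ d, algebraMap K L (w d) =
      (δ⁻¹) ^ (a : ℕ) * (δ⁻¹) ^ (b : ℕ) * (δ⁻¹) ^ (c : ℕ) * (δ⁻¹) ^ (d : ℕ) *
        circleForm q (fun i : Fin (q ^ 2 + 1) => ((δ⁻¹) ^ (i : ℕ)) ^ (q - 1)) a b c d := by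
  have : Finite K := Nat.finite_of_card_ne_zero (by rw [hK]; positivity)
  set x : Fin (q ^ 2 + 1) → L := fun i => (δ⁻¹) ^ (i : ℕ) with hx
  set z : Fin (q ^ 2 + 1) → L := fun i => x i ^ (q - 1) with hzdef
  change ∃ w ∈ negacyclicCode q K δ, ∀ d, algebraMap K L (w d) =
    x a * x b * x c * x d * circleForm q z a b c d
  have hqq : q * 3 ≤ q ^ 2 := by rw [sq]; exact Nat.mul_le_mul_left q hq3
  have hsq : q ^ 2 = (q - 1) * (q + 1) + 1 := by
    have := Nat.sq_sub_sq q 1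
    rw [one_pow, mul_comm] at this
    omega
  have e1 : ∀ i, x i * z i = x i ^ q := fun i => by
    simp only [hzdef]; rw [← pow_succ']; congr 1; omega
  have e2 : ∀ i, x i * z i ^ q = x i ^ (q ^ 2 - q + 1) := fun i => by
    simp only [hzdef]
    rw [← pow_mul, ← pow_succ', Nat.sub_mul, one_mul, ← sq]
  have e3 : ∀ i, x i * z i ^ (q + 1) = x i ^ q ^ 2 := fun i => by
    simp only [hzdef]
    rw [← pow_mul, ← pow_succ', ← hsq]
  -- Since `x i ^ q ^ 2 = x i * z i ^ (q + 1)`, the prefactor `x a * x b * x c * x d` absorbs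
  -- exactly the factor in `circleForm_pow`.
  have hfix : ∀ d, ∃ k : K, algebraMap K L k =
      x a * x b * x c * x d * circleForm q z a b c d := by
    intro d
    apply exists_algebraMap_eq_of_pow_card
    rw [hK, mul_pow]
    simp only [mul_pow, ← e3]
    have := circleForm_pow hsub (z := z) hz a b c d
    calc _ = x a * x b * x c * x d * (circleForm q z a b c d ^ q ^ 2 *
          (z a * z b * z c * z d) ^ (q + 1)) := by simp only [mul_pow]; ring
      _ = _ := by rw [this]
  choose w hw using hfix
  refine ⟨w, ?_, hw⟩
  have hδ0 : δ ≠ 0 := hδ.ne_zero (by positivity)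
  obtain ⟨r1, r2, r3, r4⟩ := aeval_checkPoly hq3 hq4 hK hδ
  let κ : L := z c - z b
  let μ : L := z c - z a
  -- The coefficients of `1, z d, z d ^ q, z d ^ (q + 1)` in the expanded circle form.
  let A : Fin 4 → L := fun k => x a * x b * x c *
    ![- κ ^ q * z a ^ q * μ * (- z b) - κ * (- z a) * μ ^ q * (- z b ^ q),
      κ ^ q * (- z a ^ q) * μ - κ * μ ^ q * (- z b ^ q),
      κ ^ q * μ * (- z b) - κ * μ ^ q * (- z a),
      κ ^ q * μ - κ * μ ^ q] k
  let Y : Fin 4 → L := ![δ⁻¹, δ⁻¹ ^ q, δ⁻¹ ^ (q ^ 2 - q + 1), δ⁻¹ ^ q ^ 2]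
  refine mem_codeOfCheck_of_eq_sum (L := L) (Nat.succ_ne_zero _)
    (checkPoly_dvd hq3 hq4 hK hL hδ) Finset.univ A Y ?_ w ?_
  · intro k _
    fin_cases k <;> simp [Y, hδ0, r1, r2, r3, r4]
  · intro d
    have t1 : Y 0 ^ (d : ℕ) = x d := rfl
    have t2 : Y 1 ^ (d : ℕ) = x d * z d := by rw [e1]; simp only [Y, hx]; exact pow_right_comm _ _ _
    have t3 : Y 2 ^ (d : ℕ) = x d * z d ^ q := by
      rw [e2]; simp only [Y, hx]; exact pow_right_comm _ _ _
    have t4 : Y 3 ^ (d : ℕ) = x d * z d ^ (q + 1) := by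
      rw [e3]; simp only [Y, hx]; exact pow_right_comm _ _ _
    rw [Fin.sum_univ_four, hw, t1, t2, t3, t4]
    have s0 : A 0 = x a * x b * x c * (- κ ^ q * z a ^ q * μ * (- z b)
      - κ * (- z a) * μ ^ q * (- z b ^ q)) := rfl
    have s1 : A 1 = x a * x b * x c * (κ ^ q * (- z a ^ q) * μ - κ * μ ^ q * (- z b ^ q)) := rfl
    have s2 : A 2 = x a * x b * x c * (κ ^ q * μ * (- z b) - κ * μ ^ q * (- z a)) := rfl
    have s3 : A 3 = x a * x b * x c * (κ ^ q * μ - κ * μ ^ q) := rfl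
    have hform : circleForm q z a b c d = κ ^ q * (z d ^ q - z a ^ q) * (μ * (z d - z b)) -
        κ * (z d - z a) * (μ ^ q * (z d ^ q - z b ^ q)) := by
      simp only [circleForm, circleNum, circleDen, mul_pow, hsub, κ, μ]
    rw [s0, s1, s2, s3, hform]
    ring

end Code

/-- The properties of a code of length `q ^ 2 + 1` which determine its weights and designs: it has
dimension at most four, any three positions are separated by codewords, and any three positions
are among the zeros of a codeword with exactly `q + 1` zeros. -/
structure IsCircleCode {K : Type*} [Field K] [DecidableEq K] (q : ℕ)
    (C : Submodule K (Fin (q ^ 2 + 1) → K)) : Prop where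
  finrank_le : Module.finrank K C ≤ 4
  exists_circle : ∀ {a b c}, a ≠ b → a ≠ c → b ≠ c → ∃ w ∈ C, w a = 0 ∧ w b = 0 ∧ w c = 0 ∧
    (Finset.univ.filter fun i => w i = 0).card = q + 1
  separates : ∀ {a b c}, a ≠ b → a ≠ c → b ≠ c → ∃ w ∈ C, w a = 0 ∧ w b = 0 ∧ w c ≠ 0

lemma isCircleCode_negacyclicCode {q : ℕ} (hq : IsPrimePow q) (hq4 : q % 4 = 3)
    {K : Type*} [Field K] [DecidableEq K] (hK : Nat.card K = q ^ 2)
    {L : Type*} [Field L] [Algebra K L] (hL : Nat.card L = q ^ 4)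
    {δ : L} (hδ : IsPrimitiveRoot δ (2 * (q ^ 2 + 1))) :
    IsCircleCode q (negacyclicCode q K δ) := by
  classical
  have hq3 : 3 ≤ q := by omega
  have : Finite K := Nat.finite_of_card_ne_zero (by rw [hK]; positivity)
  have := Fintype.ofFinite K
  have : Finite L := Nat.finite_of_card_ne_zero (by rw [hL]; positivity)
  have := Fintype.ofFinite L
  have hqq : q * 3 ≤ q ^ 2 := by rw [sq]; exact Nat.mul_le_mul_left q hq3
  have hsub : ∀ y w : L, (y - w) ^ q = y ^ q - w ^ q := by
    obtain ⟨p, k, hp, hk, rfl⟩ := hq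
    have : Fact p.Prime := ⟨hp.nat_prime⟩
    have : CharP L p := charP_of_card_eq_prime_pow (f := k * 4)
      (by rw [← Nat.card_eq_fintype_card, hL, ← pow_mul])
    intro y w
    exact sub_pow_char_pow y w k
  have hγ : IsPrimitiveRoot δ⁻¹ (2 * (q ^ 2 + 1)) := hδ.inv
  have hγ0 : δ⁻¹ ≠ 0 := hγ.ne_zero (by positivity)
  obtain ⟨m, hm, hm1, -⟩ := exponent_identities hq3 hq4
  have hz : ∀ i : Fin (q ^ 2 + 1), (((δ⁻¹) ^ (i : ℕ)) ^ (q - 1)) ^ q ^ 2 *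
      ((δ⁻¹) ^ (i : ℕ)) ^ (q - 1) = 1 := by
    intro i
    rw [← pow_succ, ← pow_mul, ← pow_mul, hm1,
      show (i : ℕ) * (2 * (2 * m + 1) * (q ^ 2 + 1)) = 2 * (q ^ 2 + 1) * (i * (2 * m + 1)) by ring,
      pow_mul, hγ.pow_eq_one, one_pow]
  -- Modulo the odd number `2 * m + 1`, `q` is 1 and `q ^ 2 + 1` is 2.
  have hcop : Nat.Coprime (2 * m + 1) (q ^ 2 + 1) := by
    have h1 : q ^ 2 + 1 = (2 * m + 1) * (8 * m + 8) + 2 := by rw [hm]; ring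
    rw [h1, Nat.coprime_mul_left_add_right]
    exact Nat.Coprime.symm (Nat.coprime_two_left.mpr ⟨m, rfl⟩)
  have hzp : IsPrimitiveRoot (δ⁻¹ ^ (q - 1)) (q ^ 2 + 1) := by
    rw [hm1, pow_mul]
    exact (hγ.pow (by positivity) rfl).pow_of_coprime _ hcop
  have hinj : Function.Injective fun i : Fin (q ^ 2 + 1) => ((δ⁻¹) ^ (i : ℕ)) ^ (q - 1) := by
    intro i j hij
    simp only [pow_right_comm _ _ (q - 1)] at hij
    exact Fin.ext (hzp.pow_inj i.isLt j.isLt hij)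
  have hword := exists_circle_word hq3 hq4 hK hL hδ hsub hz
  have hcard := fun {a b c} => card_circle (K := K) (q := q) (by omega)
    (by rw [← hK, Nat.card_eq_fintype_card]) (by simp) hsub hz hinj (a := a) (b := b) (c := c)
  set z := fun i : Fin (q ^ 2 + 1) => ((δ⁻¹) ^ (i : ℕ)) ^ (q - 1)
  have hzero : ∀ {a b c d : Fin (q ^ 2 + 1)} {k : K}, algebraMap K L k =
      (δ⁻¹) ^ (a : ℕ) * (δ⁻¹) ^ (b : ℕ) * (δ⁻¹) ^ (c : ℕ) * (δ⁻¹) ^ (d : ℕ) *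
        circleForm q z a b c d → (k = 0 ↔ circleForm q z a b c d = 0) := by
    intro a b c d k hk
    have h0 : (δ⁻¹) ^ (a : ℕ) * (δ⁻¹) ^ (b : ℕ) * (δ⁻¹) ^ (c : ℕ) * (δ⁻¹) ^ (d : ℕ) ≠ 0 := by
      simp only [← pow_add]; exact pow_ne_zero _ hγ0
    rw [← (algebraMap K L).injective.eq_iff, hk, map_zero, mul_eq_zero, or_iff_right h0]
  have hself : ∀ a b c, circleForm q z a b c a = 0 ∧ circleForm q z a b c b = 0 ∧
      circleForm q z a b c c = 0 := by
    intro a b c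
    have : q ≠ 0 := by omega
    refine ⟨?_, ?_, ?_⟩
    · simp [circleForm, circleNum, this]
    · simp [circleForm, circleDen, this]
    · simp only [circleForm, circleNum, circleDen]; rw [mul_comm (z c - z a)]; ring
  have hle : q ^ 2 + 1 ≠ 0 := Nat.succ_ne_zero _
  refine ⟨finrank_codeOfCheck_le hle (checkPoly_dvd hq3 hq4 hK hL hδ)
    (natDegree_checkPoly_le hq3 hK hL) (by omega), ?_, ?_⟩
  · intro a b c hab hac hbc
    obtain ⟨w, hwC, hw⟩ := hword a b c
    refine ⟨w, hwC, (hzero (hw a)).mpr (hself a b c).1, (hzero (hw b)).mpr (hself a b c).2.1,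
      (hzero (hw c)).mpr (hself a b c).2.2, ?_⟩
    rw [← hcard hab hac hbc]
    congr 1
    ext d
    simp only [Finset.mem_filter, Finset.mem_univ, true_and]
    exact hzero (hw d)
  · intro a b c hab hac hbc
    -- Pick `d` off the circle through `a, b, c`. Then `c` is off the circle through `a, b, d`, by
    -- `circleForm_swap`.
    obtain ⟨d, hd⟩ : ∃ d, circleForm q z a b c d ≠ 0 := by
      by_contra! h
      have := hcard hab hac hbc
      rw [Finset.filter_true_of_mem (fun d _ => h d), Finset.card_univ, Fintype.card_fin] at this
      omega
    obtain ⟨w, hwC, hw⟩ := hword a b d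
    refine ⟨w, hwC, (hzero (hw a)).mpr (hself a b d).1, (hzero (hw b)).mpr (hself a b d).2.1, ?_⟩
    rw [Ne, hzero (hw c), circleForm_swap, neg_eq_zero]
    exact hd

/-! ## Zeros of codewords -/

section Zeros

variable {K : Type*} [Field K] [DecidableEq K] {n : ℕ}

/-- The positions where a word vanishes. -/
def zeros (c : Fin n → K) : Finset (Fin n) := Finset.univ.filter fun i => c i = 0

@[simp] lemma mem_zeros {c : Fin n → K} {i : Fin n} : i ∈ zeros c ↔ c i = 0 := by simp [zeros]

lemma card_zeros_add_hammingNorm (c : Fin n → K) : (zeros c).card + hammingNorm c = n := by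
  have := Finset.card_filter_add_card_filter_not (s := (Finset.univ : Finset (Fin n)))
    (fun i => c i = 0)
  rw [Finset.card_univ, Fintype.card_fin] at this
  exact this

lemma card_zeros_eq_iff (c : Fin n → K) : (zeros c).card = n ↔ c = 0 := by
  have := card_zeros_add_hammingNorm c
  rw [← hammingNorm_eq_zero]; omega

lemma zeros_eq_compl_support (c : Fin n → K) : zeros c = (support c)ᶜ := by
  ext i; simp [support]

lemma zeros_smul {r : K} (hr : r ≠ 0) (c : Fin n → K) : zeros (r • c) = zeros c := by
  ext i; simp [hr]

lemma weightCount_zero (C : Submodule K (Fin n → K)) : weightCount C 0 = 1 := by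
  rw [weightCount, Set.ncard_eq_one]
  refine ⟨0, ?_⟩
  ext c
  simp only [Set.mem_ofPred_eq, hammingNorm_eq_zero, Set.mem_singleton_iff]
  exact ⟨fun h => h.2, fun h => ⟨h ▸ C.zero_mem, h⟩⟩

end Zeros

section Vanishing

variable {K : Type*} [Field K] {n : ℕ}

/-- The codewords which vanish on `S`. -/
def vanishing (C : Submodule K (Fin n → K)) (S : Finset (Fin n)) : Submodule K (Fin n → K) :=
  (LinearMap.ker ((LinearMap.funLeft K K (Subtype.val : S → Fin n)).comp C.subtype)).map C.subtype

lemma mem_vanishing {C : Submodule K (Fin n → K)} {S : Finset (Fin n)} {w : Fin n → K} :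
    w ∈ vanishing C S ↔ w ∈ C ∧ ∀ i ∈ S, w i = 0 := by
  unfold vanishing
  rw [Submodule.mem_map]
  constructor
  · rintro ⟨⟨v, hv⟩, hk, rfl⟩
    refine ⟨hv, fun i hi => ?_⟩
    exact congrFun (LinearMap.mem_ker.mp hk) ⟨i, hi⟩
  · rintro ⟨hw, h0⟩
    refine ⟨⟨w, hw⟩, ?_, rfl⟩
    rw [LinearMap.mem_ker]
    ext ⟨i, hi⟩
    exact h0 i hi

end Vanishing

/-! ### Dimension and zero sets of the words of a circle code. -/

namespace IsCircleCode

variable {K : Type*} [Field K] [DecidableEq K] {q : ℕ} {C : Submodule K (Fin (q ^ 2 + 1) → K)}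

lemma separates_finset (h : IsCircleCode q C) (hq : 3 ≤ q) {S : Finset (Fin (q ^ 2 + 1))}
    (hS : S.card ≤ 3) (i : Fin (q ^ 2 + 1)) (hi : i ∈ S) :
    ∃ w ∈ C, w i ≠ 0 ∧ ∀ j ∈ S, j ≠ i → w j = 0 := by
  have hqq : q * 3 ≤ q ^ 2 := by rw [sq]; exact Nat.mul_le_mul_left q hq
  obtain ⟨S', hSS', hS'⟩ := Finset.exists_superset_card_eq hS (by rw [Fintype.card_fin]; omega)
  have hc : (S'.erase i).card = 2 := by rw [Finset.card_erase_of_mem (hSS' hi), hS']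
  obtain ⟨a, b, hab, he⟩ := Finset.card_eq_two.mp hc
  have ha : a ∈ S'.erase i := by simp [he]
  have hb : b ∈ S'.erase i := by simp [he]
  obtain ⟨w, hw, h1, h2, h3⟩ := h.separates hab (Finset.ne_of_mem_erase ha)
    (Finset.ne_of_mem_erase hb)
  refine ⟨w, hw, h3, fun j hj hji => ?_⟩
  have : j ∈ S'.erase i := Finset.mem_erase.mpr ⟨hji, hSS' hj⟩
  rw [he, Finset.mem_insert, Finset.mem_singleton] at this
  rcases this with rfl | rfl <;> assumption

/-- The separating words make restriction to `S` surjective on `C`, and its kernel is `vanishing C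
S`. -/
lemma finrank_vanishing_add (h : IsCircleCode q C) (hq : 3 ≤ q) {S : Finset (Fin (q ^ 2 + 1))}
    (hS : S.card ≤ 3) :
    Module.finrank K (vanishing C S) + S.card = Module.finrank K C := by
  classical
  set f := (LinearMap.funLeft K K (Subtype.val : S → Fin (q ^ 2 + 1))).comp C.subtype with hf
  have hsurj : Function.Surjective f := by
    intro g
    choose w hwC hw hw0 using fun i : S => h.separates_finset hq hS i i.2
    refine ⟨∑ i : S, (g i / w i i) • (⟨w i, hwC i⟩ : C), ?_⟩
    rw [map_sum]
    ext j
    rw [Finset.sum_apply, Finset.sum_eq_single j]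
    · rw [map_smul]
      change g j / w j j * w j j = g j
      rw [div_mul_cancel₀ _ (hw j)]
    · intro i _ hij
      rw [map_smul]
      change g i / w i i * w i j = 0
      rw [hw0 i j j.2 (fun h => hij (Subtype.ext h.symm)), mul_zero]
    · simp
  have h1 := LinearMap.finrank_range_add_finrank_ker f
  rw [LinearMap.range_eq_top.mpr hsurj, finrank_top, Module.finrank_fintype_fun_eq_card,
    Fintype.card_coe] at h1
  have h2 : Module.finrank K (vanishing C S) = Module.finrank K (LinearMap.ker f) :=
    Submodule.finrank_map_subtype_eq _ _
  omega

lemma exists_circle_finset (h : IsCircleCode q C) {T : Finset (Fin (q ^ 2 + 1))}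
    (hT : T.card = 3) : ∃ w ∈ C, T ⊆ zeros w ∧ (zeros w).card = q + 1 := by
  obtain ⟨a, b, c, hab, hac, hbc, rfl⟩ := Finset.card_eq_three.mp hT
  obtain ⟨w, hw, h1, h2, h3, h4⟩ := h.exists_circle hab hac hbc
  refine ⟨w, hw, ?_, h4⟩
  intro i hi
  simp only [Finset.mem_insert, Finset.mem_singleton] at hi
  rcases hi with rfl | rfl | rfl <;> simpa

lemma ne_zero_of_card_zeros (hq : 3 ≤ q) {w : Fin (q ^ 2 + 1) → K}
    (hw : (zeros w).card ≤ q + 1) : w ≠ 0 := by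
  have hqq : q * 3 ≤ q ^ 2 := by rw [sq]; exact Nat.mul_le_mul_left q hq
  intro h
  rw [← card_zeros_eq_iff] at h
  omega

/-- A circle word survives the three independent conditions of vanishing on `T`, so the dimension is
at least `3 + 1`. -/
lemma finrank_eq (h : IsCircleCode q C) (hq : 3 ≤ q) : Module.finrank K C = 4 := by
  have hqq : q * 3 ≤ q ^ 2 := by rw [sq]; exact Nat.mul_le_mul_left q hq
  obtain ⟨T, -, hT⟩ := Finset.exists_subset_card_eq (s := (Finset.univ : Finset (Fin (q ^ 2 + 1))))
    (n := 3) (by rw [Finset.card_univ, Fintype.card_fin]; omega)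
  have h1 := h.finrank_vanishing_add hq hT.le
  obtain ⟨w, hw, hTw, hwz⟩ := h.exists_circle_finset hT
  have h2 : 0 < Module.finrank K (vanishing C T) := by
    rw [Module.finrank_pos_iff_exists_ne_zero]
    refine ⟨⟨w, mem_vanishing.mpr ⟨hw, fun i hi => mem_zeros.mp (hTw hi)⟩⟩, ?_⟩
    intro h0
    exact ne_zero_of_card_zeros hq hwz.le (congrArg Subtype.val h0)
  have := h.finrank_le
  omega

/-- Codewords vanishing at three given positions are proportional. -/
lemma exists_smul_eq (h : IsCircleCode q C) (hq : 3 ≤ q) {T : Finset (Fin (q ^ 2 + 1))}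
    (hT : T.card = 3) {v w : Fin (q ^ 2 + 1) → K} (hv : v ∈ C) (hv0 : v ≠ 0) (hTv : T ⊆ zeros v)
    (hw : w ∈ C) (hTw : T ⊆ zeros w) : ∃ r : K, r • v = w := by
  have h1 := h.finrank_vanishing_add hq hT.le
  rw [h.finrank_eq hq, hT] at h1
  have h2 : Module.finrank K (vanishing C T) = 1 := by omega
  let v' : vanishing C T := ⟨v, mem_vanishing.mpr ⟨hv, fun i hi => mem_zeros.mp (hTv hi)⟩⟩
  let w' : vanishing C T := ⟨w, mem_vanishing.mpr ⟨hw, fun i hi => mem_zeros.mp (hTw hi)⟩⟩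
  obtain ⟨r, hr⟩ := (finrank_eq_one_iff_of_nonzero' v'
    (fun h0 => hv0 (congrArg Subtype.val h0))).mp h2 w'
  exact ⟨r, congrArg Subtype.val hr⟩

lemma zeros_eq_of_subset (h : IsCircleCode q C) (hq : 3 ≤ q) {T : Finset (Fin (q ^ 2 + 1))}
    (hT : T.card = 3) {v w : Fin (q ^ 2 + 1) → K} (hv : v ∈ C) (hv0 : v ≠ 0) (hTv : T ⊆ zeros v)
    (hw : w ∈ C) (hw0 : w ≠ 0) (hTw : T ⊆ zeros w) : zeros w = zeros v := by
  obtain ⟨r, rfl⟩ := h.exists_smul_eq hq hT hv hv0 hTv hw hTw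
  exact zeros_smul (fun hr => hw0 (by rw [hr, zero_smul])) v

lemma card_zeros_eq (h : IsCircleCode q C) (hq : 3 ≤ q) {w : Fin (q ^ 2 + 1) → K} (hw : w ∈ C)
    (hw0 : w ≠ 0) (h3 : 3 ≤ (zeros w).card) : (zeros w).card = q + 1 := by
  obtain ⟨T, hTw, hT⟩ := Finset.exists_subset_card_eq h3
  obtain ⟨v, hv, hTv, hvz⟩ := h.exists_circle_finset hT
  rw [h.zeros_eq_of_subset hq hT hv (ne_zero_of_card_zeros hq hvz.le) hTv hw hw0 hTw, hvz]

lemma card_zeros_mem (h : IsCircleCode q C) (hq : 3 ≤ q) {w : Fin (q ^ 2 + 1) → K} (hw : w ∈ C) :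
    (zeros w).card ∈ ({0, 1, 2, q + 1, q ^ 2 + 1} : Finset ℕ) := by
  simp only [Finset.mem_insert, Finset.mem_singleton]
  by_cases hw0 : w = 0
  · have := (card_zeros_eq_iff w).mpr hw0
    omega
  · by_cases h3 : 3 ≤ (zeros w).card
    · have := h.card_zeros_eq hq hw hw0 h3; omega
    · omega

lemma exists_circle_word (h : IsCircleCode q C) (hq : 3 ≤ q) :
    ∃ w ∈ C, (zeros w).card = q + 1 := by
  have hqq : q * 3 ≤ q ^ 2 := by rw [sq]; exact Nat.mul_le_mul_left q hq
  obtain ⟨T, -, hT⟩ := Finset.exists_subset_card_eq (s := (Finset.univ : Finset (Fin (q ^ 2 + 1))))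
    (n := 3) (by rw [Finset.card_univ, Fintype.card_fin]; omega)
  obtain ⟨w, hw, -, hwz⟩ := h.exists_circle_finset hT
  exact ⟨w, hw, hwz⟩

lemma hammingNorm_eq_iff (hq : 3 ≤ q) (w : Fin (q ^ 2 + 1) → K) :
    hammingNorm w = q ^ 2 - q ↔ (zeros w).card = q + 1 := by
  have hqq : q * 3 ≤ q ^ 2 := by rw [sq]; exact Nat.mul_le_mul_left q hq
  have := card_zeros_add_hammingNorm w
  omega

end IsCircleCode

/-- The minimum distance of a linear code is its minimum weight. -/
lemma isLeast_hammingDist_of_isLeast {K : Type*} [Field K] [DecidableEq K] {n : ℕ}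
    {C : Submodule K (Fin n → K)} {d : ℕ} (hle : ∀ w ∈ C, w ≠ 0 → d ≤ hammingNorm w)
    (hex : ∃ w ∈ C, w ≠ 0 ∧ hammingNorm w = d) :
    IsLeast {e : ℕ | ∃ x ∈ C, ∃ y ∈ C, x ≠ y ∧ hammingDist x y = e} d := by
  constructor
  · obtain ⟨w, hw, hw0, hwd⟩ := hex
    exact ⟨w, hw, 0, C.zero_mem, hw0, by rw [hammingDist_zero_right, hwd]⟩
  · rintro e ⟨x, hx, y, hy, hxy, rfl⟩
    rw [hammingDist_comm, hammingDist_eq_hammingNorm]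
    exact hle _ (C.add_mem (C.neg_mem hy) hx)
      (by rwa [Ne, neg_add_eq_zero, eq_comm])

lemma IsCircleCode.hasParameters {K : Type*} [Field K] [DecidableEq K] {q : ℕ}
    {C : Submodule K (Fin (q ^ 2 + 1) → K)} (h : IsCircleCode q C) (hq : 3 ≤ q) :
    HasParameters C 4 (q ^ 2 - q) := by
  have hqq : q * 3 ≤ q ^ 2 := by rw [sq]; exact Nat.mul_le_mul_left q hq
  refine ⟨h.finrank_eq hq, isLeast_hammingDist_of_isLeast ?_ ?_⟩
  · intro w hw hw0
    have h1 := card_zeros_add_hammingNorm w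
    by_cases h3 : 3 ≤ (zeros w).card
    · have := h.card_zeros_eq hq hw hw0 h3; omega
    · omega
  · obtain ⟨w, hw, hwz⟩ := h.exists_circle_word hq
    exact ⟨w, hw, ne_zero_of_card_zeros hq hwz.le, (hammingNorm_eq_iff hq w).mpr hwz⟩

/-! ## The weight distribution -/

lemma cast_choose_three (n : ℕ) : (n.choose 3 : ℚ) = n * (n - 1) * (n - 2) / 6 := by
  induction n with
  | zero => simp
  | succ n ih =>
    rw [Nat.choose_succ_succ, Nat.cast_add, ih, Nat.cast_choose_two]
    push_cast
    ring

lemma card_filter_mem_submodule {K V : Type*} [Field K] [Finite K] [AddCommGroup V] [Module K V]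
    [Fintype V] (W : Submodule K V) [DecidablePred (· ∈ W)] :
    (Finset.univ.filter (· ∈ W)).card = Nat.card K ^ Module.finrank K W := by
  rw [← Module.natCard_eq_pow_finrank (K := K) (V := W), Nat.card_eq_fintype_card,
    Fintype.card_subtype]

namespace IsCircleCode

variable {K : Type*} [Field K] [Fintype K] [DecidableEq K] {q : ℕ}
  {C : Submodule K (Fin (q ^ 2 + 1) → K)}

open scoped Classical in
/-- The power moments of the numbers of zeros of the codewords. -/
lemma sum_choose_card_zeros (h : IsCircleCode q C) (hq : 3 ≤ q) (hK : Fintype.card K = q ^ 2)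
    {j : ℕ} (hj : j ≤ 3) :
    ∑ c ∈ Finset.univ.filter (· ∈ C), (zeros c).card.choose j =
      (q ^ 2 + 1).choose j * (q ^ 2) ^ (4 - j) := by
  -- Double counting of pairs of a codeword and a `j`-set of its zeros; each `j`-set is killed by a
  -- subspace of dimension `4 - j`.
  have h1 : ∀ c : Fin (q ^ 2 + 1) → K, (zeros c).card.choose j =
      ∑ S ∈ Finset.powersetCard j Finset.univ, if S ⊆ zeros c then 1 else 0 := by
    intro c
    rw [← Finset.card_filter, ← Finset.card_powersetCard]
    congr 1
    ext S
    simp only [Finset.mem_powersetCard, Finset.mem_filter, Finset.subset_univ, true_and]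
    exact and_comm
  simp only [h1]
  rw [Finset.sum_comm]
  have h2 : ∀ S ∈ Finset.powersetCard j (Finset.univ : Finset (Fin (q ^ 2 + 1))),
      (∑ c ∈ Finset.univ.filter (· ∈ C), if S ⊆ zeros c then 1 else 0) = (q ^ 2) ^ (4 - j) := by
    intro S hS
    have hSj := (Finset.mem_powersetCard.mp hS).2
    rw [← Finset.card_filter, Finset.filter_filter]
    have h3 := h.finrank_vanishing_add hq (S := S) (by omega)
    rw [h.finrank_eq hq, hSj] at h3
    rw [show 4 - j = Module.finrank K (vanishing C S) by omega]
    refine Eq.trans ?_ ((card_filter_mem_submodule (vanishing C S)).trans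
      (by rw [Nat.card_eq_fintype_card, hK]))
    congr 1
    ext c
    simp only [Finset.mem_filter, Finset.mem_univ, true_and, mem_vanishing, Finset.subset_iff,
      mem_zeros]
  rw [Finset.sum_congr rfl h2, Finset.sum_const, Finset.card_powersetCard, Finset.card_univ,
    Fintype.card_fin, smul_eq_mul]

open scoped Classical in
lemma weightCount_eq (C : Submodule K (Fin (q ^ 2 + 1) → K)) {w : ℕ} (hw : w ≤ q ^ 2 + 1) :
    weightCount C w = ((Finset.univ.filter (· ∈ C)).filter
      fun c => (zeros c).card = q ^ 2 + 1 - w).card := by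
  rw [weightCount, ← Set.ncard_coe_finset]
  congr 1
  ext c
  have := card_zeros_add_hammingNorm c
  simp only [Set.mem_ofPred_eq, Finset.coe_filter, Finset.mem_filter, Finset.mem_univ, true_and]
  refine and_congr_right fun _ => ?_
  omega

lemma sum_weightCount_mul_choose (h : IsCircleCode q C) (hq : 3 ≤ q)
    (hK : Fintype.card K = q ^ 2) {j : ℕ} (hj : j ≤ 3) :
    weightCount C (q ^ 2 + 1) * Nat.choose 0 j + (weightCount C (q ^ 2) * Nat.choose 1 j +
      (weightCount C (q ^ 2 - 1) * Nat.choose 2 j + (weightCount C (q ^ 2 - q) * Nat.choose (q + 1) j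
        + weightCount C 0 * Nat.choose (q ^ 2 + 1) j))) =
      (q ^ 2 + 1).choose j * (q ^ 2) ^ (4 - j) := by
  classical
  have hqq : q * 3 ≤ q ^ 2 := by rw [sq]; exact Nat.mul_le_mul_left q hq
  rw [← h.sum_choose_card_zeros hq hK hj, ← Finset.sum_fiberwise_of_maps_to
    (t := ({0, 1, 2, q + 1, q ^ 2 + 1} : Finset ℕ)) (g := fun c => (zeros c).card)
    (fun c hc => h.card_zeros_mem hq (Finset.mem_filter.mp hc).2)]
  have h1 : ∀ k w : ℕ, w ≤ q ^ 2 + 1 → q ^ 2 + 1 - w = k →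
      (∑ c ∈ (Finset.univ.filter (· ∈ C)).filter fun c => (zeros c).card = k,
        (zeros c).card.choose j) = weightCount C w * k.choose j := by
    rintro k w hw rfl
    rw [weightCount_eq C hw, ← smul_eq_mul, ← Finset.sum_const]
    refine Finset.sum_congr rfl fun c hc => ?_
    rw [(Finset.mem_filter.mp hc).2]
  rw [Finset.sum_insert, Finset.sum_insert, Finset.sum_insert, Finset.sum_insert,
    Finset.sum_singleton, h1 0 (q ^ 2 + 1), h1 1 (q ^ 2), h1 2 (q ^ 2 - 1), h1 (q + 1) (q ^ 2 - q),
    h1 (q ^ 2 + 1) 0]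
  all_goals first
    | omega
    | (simp only [Finset.mem_insert, Finset.mem_singleton]; omega)

/-- The moment equations are triangular. Among nonzero words only those with `q + 1` zeros enter the
third moment; the second, first and zeroth then bring in words with 2, 1 and 0 zeros in turn. -/
lemma weightCount_values (h : IsCircleCode q C) (hq : 3 ≤ q) (hK : Fintype.card K = q ^ 2) :
    (weightCount C (q ^ 2 - q) : ℚ) = (q : ℚ) ^ 5 - q ∧
    (weightCount C (q ^ 2 - 1) : ℚ) = (((q : ℚ) ^ 4 - 1) * ((q : ℚ) - 1) * (q : ℚ) ^ 3) / 2 ∧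
    (weightCount C (q ^ 2) : ℚ) = (q : ℚ) ^ 7 - (q : ℚ) ^ 5 + (q : ℚ) ^ 4 - (q : ℚ) ^ 3 + q - 1 ∧
    (weightCount C (q ^ 2 + 1) : ℚ) = (((q : ℚ) ^ 4 - 1) * ((q : ℚ) - 1) * (q : ℚ) ^ 3) / 2 := by
  have m0 := congrArg (Nat.cast : ℕ → ℚ) (h.sum_weightCount_mul_choose hq hK (j := 0) (by omega))
  have m1 := congrArg (Nat.cast : ℕ → ℚ) (h.sum_weightCount_mul_choose hq hK (j := 1) (by omega))
  have m2 := congrArg (Nat.cast : ℕ → ℚ) (h.sum_weightCount_mul_choose hq hK (j := 2) (by omega))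
  have m3 := congrArg (Nat.cast : ℕ → ℚ) (h.sum_weightCount_mul_choose hq hK (j := 3) (by omega))
  rw [weightCount_zero] at m0 m1 m2 m3
  push_cast [cast_choose_three, Nat.cast_choose_two, Nat.choose_zero_right, Nat.choose_one_right]
    at m0 m1 m2 m3
  have hq0 : ((q : ℚ) + 1) * q * (q - 1) ≠ 0 := by
    have : (3 : ℚ) ≤ q := by exact_mod_cast hq
    have h1 : (q : ℚ) - 1 ≠ 0 := by linarith
    positivity
  generalize (weightCount C (q ^ 2 - q) : ℚ) = a at *
  generalize (weightCount C (q ^ 2 - 1) : ℚ) = b at *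
  generalize (weightCount C (q ^ 2) : ℚ) = c at *
  generalize (weightCount C (q ^ 2 + 1) : ℚ) = d at *
  have ha : a = (q : ℚ) ^ 5 - q := by
    apply mul_left_cancel₀ hq0
    linear_combination 6 * m3
  subst ha
  have hb : b = (((q : ℚ) ^ 4 - 1) * ((q : ℚ) - 1) * (q : ℚ) ^ 3) / 2 := by
    linear_combination m2
  subst hb
  have hc : c = (q : ℚ) ^ 7 - (q : ℚ) ^ 5 + (q : ℚ) ^ 4 - (q : ℚ) ^ 3 + q - 1 := by
    linear_combination m1
  subst hc
  refine ⟨rfl, rfl, rfl, ?_⟩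
  linear_combination m0

theorem weightEnumerator_eq (h : IsCircleCode q C) (hq : 3 ≤ q) (hK : Fintype.card K = q ^ 2) :
    weightEnumerator C =
      1 + Polynomial.C ((q : ℚ) ^ 5 - q) * X ^ (q ^ 2 - q)
        + Polynomial.C ((((q : ℚ) ^ 4 - 1) * ((q : ℚ) - 1) * (q : ℚ) ^ 3) / 2)
          * (X ^ (q ^ 2 - 1) + X ^ (q ^ 2 + 1))
        + Polynomial.C ((q : ℚ) ^ 7 - (q : ℚ) ^ 5 + (q : ℚ) ^ 4 - (q : ℚ) ^ 3 + (q : ℚ) - 1)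
          * X ^ (q ^ 2) := by
  classical
  have hqq : q * 3 ≤ q ^ 2 := by rw [sq]; exact Nat.mul_le_mul_left q hq
  obtain ⟨h1, h2, h3, h4⟩ := h.weightCount_values hq hK
  rw [weightEnumerator, ← Finset.sum_subset
    (s₁ := ({0, q ^ 2 - q, q ^ 2 - 1, q ^ 2, q ^ 2 + 1} : Finset ℕ))]
  · rw [Finset.sum_insert, Finset.sum_insert, Finset.sum_insert, Finset.sum_insert,
      Finset.sum_singleton, weightCount_zero, h1, h2, h3, h4]
    · simp only [Nat.cast_one, C_1, pow_zero]
      ring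
    all_goals (simp only [Finset.mem_insert, Finset.mem_singleton]; omega)
  · intro w hw
    simp only [Finset.mem_insert, Finset.mem_singleton] at hw
    rw [Finset.mem_range]
    omega
  · intro w hw hw'
    rw [Finset.mem_range] at hw
    simp only [Finset.mem_insert, Finset.mem_singleton] at hw'
    have : weightCount C w = 0 := by
      rw [weightCount_eq C (by omega), Finset.card_eq_zero, Finset.filter_eq_empty_iff]
      intro c hc hcw
      have := h.card_zeros_mem hq (Finset.mem_filter.mp hc).2
      simp only [Finset.mem_insert, Finset.mem_singleton] at this
      omega
    rw [this]
    simp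

end IsCircleCode

/-! ## Counting blocks of a design -/

section Blocks

variable {P : Type*} [Fintype P] [DecidableEq P] {B : Finset (Finset P)}

/-- Count in two ways the pairs of a point outside `S` and a block containing it and `S`. -/
lemma card_blocks_containing_mul {κ l : ℕ} (hκ : ∀ b ∈ B, b.card = κ) (S : Finset P)
    (hl : ∀ x ∉ S, (B.filter fun b => insert x S ⊆ b).card = l) :
    (B.filter fun b => S ⊆ b).card * (κ - S.card) = (Fintype.card P - S.card) * l := by
  have h := Finset.sum_card_bipartiteAbove_eq_sum_card_bipartiteBelow
    (s := Sᶜ) (t := B.filter fun b => S ⊆ b) (fun x b => x ∈ b)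
  have h1 : ∀ x ∈ Sᶜ, (Finset.bipartiteAbove (fun x b => x ∈ b)
      (B.filter fun b => S ⊆ b) x).card = l := by
    intro x hx
    rw [← hl x (Finset.mem_compl.mp hx), Finset.bipartiteAbove, Finset.filter_filter]
    congr 1
    ext b
    simp only [Finset.mem_filter, Finset.insert_subset_iff]
    tauto
  have h2 : ∀ b ∈ B.filter fun b => S ⊆ b, (Finset.bipartiteBelow (fun x b => x ∈ b)
      Sᶜ b).card = κ - S.card := by
    intro b hb
    obtain ⟨hbB, hSb⟩ := Finset.mem_filter.mp hb
    rw [← hκ b hbB, ← Finset.card_sdiff_of_subset hSb, Finset.bipartiteBelow]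
    congr 1
    ext x
    simp only [Finset.mem_filter, Finset.mem_compl, Finset.mem_sdiff]
    tauto
  rw [Finset.sum_congr rfl h1, Finset.sum_congr rfl h2, Finset.sum_const, Finset.sum_const,
    Finset.card_compl, smul_eq_mul, smul_eq_mul] at h
  exact h.symm

variable {q : ℕ}

/-- The number of blocks of an inversive plane of order `q` through at most two points. -/
lemma card_blocks_inversive (hq : 3 ≤ q) (hP : Fintype.card P = q ^ 2 + 1)
    (hκ : ∀ b ∈ B, b.card = q + 1)
    (h3 : ∀ T : Finset P, T.card = 3 → (B.filter fun b => T ⊆ b).card = 1) :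
    (∀ T : Finset P, T.card = 2 → (B.filter fun b => T ⊆ b).card = q + 1) ∧
    (∀ T : Finset P, T.card = 1 → (B.filter fun b => T ⊆ b).card = q * (q + 1)) ∧
    B.card = q * (q ^ 2 + 1) := by
  have hqq : q * 3 ≤ q ^ 2 := by rw [sq]; exact Nat.mul_le_mul_left q hq
  have h2 : ∀ T : Finset P, T.card = 2 → (B.filter fun b => T ⊆ b).card = q + 1 := by
    intro T hT
    have := card_blocks_containing_mul hκ T
      (fun x hx => h3 _ (by rw [Finset.card_insert_of_notMem hx, hT]))
    rw [hT, hP] at this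
    apply Nat.eq_of_mul_eq_mul_right (show 0 < q + 1 - 2 by omega)
    rw [this]
    obtain ⟨m, rfl⟩ := Nat.exists_eq_add_of_le hq
    have e1 : (3 + m) ^ 2 + 1 - 2 = m ^ 2 + 6 * m + 8 := by
      have : (3 + m) ^ 2 = m ^ 2 + 6 * m + 9 := by ring
      omega
    have e2 : 3 + m + 1 - 2 = m + 2 := by omega
    rw [e1, e2]; ring
  have h1 : ∀ T : Finset P, T.card = 1 → (B.filter fun b => T ⊆ b).card = q * (q + 1) := by
    intro T hT
    have := card_blocks_containing_mul hκ T
      (fun x hx => h2 _ (by rw [Finset.card_insert_of_notMem hx, hT]))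
    rw [hT, hP] at this
    apply Nat.eq_of_mul_eq_mul_right (show 0 < q + 1 - 1 by omega)
    rw [this, Nat.add_sub_cancel, Nat.add_sub_cancel]
    ring
  refine ⟨h2, h1, ?_⟩
  have := card_blocks_containing_mul hκ ∅
    (fun x hx => h1 _ (by rw [Finset.card_insert_of_notMem hx, Finset.card_empty]))
  rw [Finset.card_empty, hP, Finset.filter_true_of_mem (fun b _ => Finset.empty_subset b)] at this
  apply Nat.eq_of_mul_eq_mul_right (show 0 < q + 1 - 0 by omega)
  rw [this, Nat.sub_zero, Nat.sub_zero]
  ring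

/-- The number of blocks of an inversive plane of order `q` missing three given points. -/
lemma card_blocks_disjoint (hq : 3 ≤ q) (hP : Fintype.card P = q ^ 2 + 1)
    (hκ : ∀ b ∈ B, b.card = q + 1)
    (h3 : ∀ T : Finset P, T.card = 3 → (B.filter fun b => T ⊆ b).card = 1)
    {T : Finset P} (hT : T.card = 3) :
    (B.filter fun b => Disjoint T b).card = (q ^ 2 - q - 1) * (q - 2) := by
  have hqq : q * 3 ≤ q ^ 2 := by rw [sq]; exact Nat.mul_le_mul_left q hq
  obtain ⟨h2, h1, h0⟩ := card_blocks_inversive hq hP hκ h3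
  have hTT := h3 T hT
  obtain ⟨x, y, z, hxy, hxz, hyz, rfl⟩ := Finset.card_eq_three.mp hT
  let f : P → Finset P → ℤ := fun p b => if p ∈ b then 1 else 0
  have s0 : ∑ b ∈ B, (1 : ℤ) = q * (q ^ 2 + 1) := by
    rw [Finset.sum_const, h0]; simp
  have s1 : ∀ p, ∑ b ∈ B, f p b = q * (q + 1) := by
    intro p
    have := h1 {p} (Finset.card_singleton p)
    simp only [f, ← Finset.natCast_card_filter, ← Finset.singleton_subset_iff, this]
    push_cast; ring
  have s2 : ∀ p r, p ≠ r → ∑ b ∈ B, f p b * f r b = q + 1 := by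
    intro p r hpr
    have := h2 {p, r} (Finset.card_pair hpr)
    have e : ∀ b, f p b * f r b = if {p, r} ⊆ b then 1 else 0 := by
      intro b
      simp only [f, Finset.insert_subset_iff, Finset.singleton_subset_iff]
      split_ifs <;> simp_all
    simp only [e, ← Finset.natCast_card_filter, this]
    push_cast; ring
  have s3 : ∑ b ∈ B, f x b * f y b * f z b = 1 := by
    have e : ∀ b, f x b * f y b * f z b = if {x, y, z} ⊆ b then 1 else 0 := by
      intro b
      simp only [f, Finset.insert_subset_iff, Finset.singleton_subset_iff]
      split_ifs <;> simp_all
    simp only [e, ← Finset.natCast_card_filter, hTT]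
    simp
  -- Inclusion-exclusion: the indicator is `(1 - f x b) * (1 - f y b) * (1 - f z b)`, expanded.
  have hd : ∀ b, (if Disjoint {x, y, z} b then (1 : ℤ) else 0) =
      1 - (f x b + f y b + f z b) + (f x b * f y b + f x b * f z b + f y b * f z b)
        - f x b * f y b * f z b := by
    intro b
    simp only [f, Finset.disjoint_insert_left, Finset.disjoint_singleton_left]
    split_ifs <;> simp_all
  have key : ((B.filter fun b => Disjoint {x, y, z} b).card : ℤ) =
      ((q : ℤ) ^ 2 - q - 1) * (q - 2) := by
    rw [Finset.natCast_card_filter]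
    simp only [hd, Finset.sum_sub_distrib, Finset.sum_add_distrib, s0, s1, s2 x y hxy, s2 x z hxz,
      s2 y z hyz, s3]
    ring
  zify
  rw [key, Nat.sub_sub, Nat.cast_sub (by omega), Nat.cast_sub (by omega)]
  push_cast
  ring

end Blocks

/-- The dual is the orthogonal space for the bilinear form of the identity matrix, which is
nondegenerate. -/
lemma finrank_dualCode {K : Type*} [Field K] {n : ℕ} (C : Submodule K (Fin n → K)) :
    Module.finrank K (dualCode C) = n - Module.finrank K C := by
  have h := LinearMap.BilinForm.finrank_orthogonal
    (B := Matrix.toBilin' (1 : Matrix (Fin n) (Fin n) K))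
    (LinearMap.BilinForm.nondegenerate_toBilin'_of_det_ne_zero' 1 (by simp)) C
  rw [Module.finrank_fin_fun] at h
  have e : dualCode C = (Matrix.toBilin' (1 : Matrix (Fin n) (Fin n) K)).orthogonal C := by
    ext y
    have h1 : ∀ x, Matrix.toBilin' (1 : Matrix (Fin n) (Fin n) K) x y = ∑ i, x i * y i := by
      intro x
      rw [Matrix.toBilin'_apply', Matrix.one_mulVec]
      rfl
    simp only [LinearMap.BilinForm.mem_orthogonal_iff]
    constructor
    · intro hy x hx; exact (h1 x).trans (hy x hx)
    · intro hy x hx; exact (h1 x).symm.trans (hy x hx)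
  rw [e, h]

/-! ## The designs of the code and of its dual -/

namespace IsCircleCode

variable {K : Type*} [Field K] [DecidableEq K] {q : ℕ} {C : Submodule K (Fin (q ^ 2 + 1) → K)}

/-- The circles: the zero sets of the codewords with `q + 1` zeros. -/
def circles (C : Submodule K (Fin (q ^ 2 + 1) → K)) : Set (Finset (Fin (q ^ 2 + 1))) :=
  {b | ∃ c ∈ C, (zeros c).card = q + 1 ∧ b = zeros c}

lemma mem_supportBlocks_iff (hq : 3 ≤ q) (C : Submodule K (Fin (q ^ 2 + 1) → K))
    (b : Finset (Fin (q ^ 2 + 1))) : b ∈ supportBlocks C (q ^ 2 - q) ↔ bᶜ ∈ circles C := by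
  simp only [supportBlocks, circles, Set.mem_ofPred_eq, hammingNorm_eq_iff hq,
    zeros_eq_compl_support, compl_inj_iff]

lemma complementBlocks_supportBlocks (hq : 3 ≤ q) (C : Submodule K (Fin (q ^ 2 + 1) → K)) :
    complementBlocks (supportBlocks C (q ^ 2 - q)) = circles C := by
  ext b
  simp only [complementBlocks, Set.mem_ofPred_eq, mem_supportBlocks_iff hq]
  constructor
  · rintro ⟨a, ha, rfl⟩; exact ha
  · intro hb; exact ⟨bᶜ, by rwa [compl_compl], (compl_compl b).symm⟩

lemma card_of_mem_circles {b : Finset (Fin (q ^ 2 + 1))} (hb : b ∈ circles C) :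
    b.card = q + 1 := by
  obtain ⟨c, -, h, rfl⟩ := hb; exact h

lemma exists_unique_circle (h : IsCircleCode q C) (hq : 3 ≤ q) {T : Finset (Fin (q ^ 2 + 1))}
    (hT : T.card = 3) : ∃ b₀, ∀ b, b ∈ circles C ∧ T ⊆ b ↔ b = b₀ := by
  obtain ⟨w, hw, hTw, hwz⟩ := h.exists_circle_finset hT
  refine ⟨zeros w, fun b => ⟨?_, ?_⟩⟩
  · rintro ⟨⟨c, hc, hcz, rfl⟩, hTc⟩
    exact h.zeros_eq_of_subset hq hT hw (ne_zero_of_card_zeros hq hwz.le) hTw hc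
      (ne_zero_of_card_zeros hq hcz.le) hTc
  · rintro rfl
    exact ⟨⟨w, hw, hwz, rfl⟩, hTw⟩

theorem isSteinerSystem (h : IsCircleCode q C) (hq : 3 ≤ q) :
    IsSteinerSystem 3 (q + 1) (q ^ 2 + 1)
      (complementBlocks (supportBlocks C (q ^ 2 - q))) := by
  have hqq : q * 3 ≤ q ^ 2 := by rw [sq]; exact Nat.mul_le_mul_left q hq
  rw [complementBlocks_supportBlocks hq]
  refine ⟨by omega, Fintype.card_fin _, by omega, by omega, fun b => card_of_mem_circles, ?_⟩
  intro T hT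
  obtain ⟨b₀, hb₀⟩ := h.exists_unique_circle hq hT
  rw [Set.ncard_eq_one]
  exact ⟨b₀, Set.ext hb₀⟩

/-- Supports of minimum weight words are complements of circles, so the blocks through `T`
correspond to the circles disjoint from `T`. -/
theorem supportsDesign [Finite K] (h : IsCircleCode q C) (hq : 3 ≤ q) :
    SupportsDesign C 3 (q ^ 2 - q) ((q ^ 2 - q - 1) * (q - 2)) := by
  classical
  have hqq : q * 3 ≤ q ^ 2 := by rw [sq]; exact Nat.mul_le_mul_left q hq
  refine ⟨by omega, Nat.mul_pos (by omega) (by omega), ?_, Fintype.card_fin _, by omega,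
    by omega, ?_, ?_⟩
  · obtain ⟨w, hw, hwz⟩ := h.exists_circle_word hq
    rw [weightCount]
    exact Set.ncard_ne_zero_of_mem (a := w) ⟨hw, (hammingNorm_eq_iff hq w).mpr hwz⟩
      (Set.toFinite _)
  · intro b hb
    rw [mem_supportBlocks_iff hq] at hb
    have h1 := card_of_mem_circles hb
    rw [Finset.card_compl, Fintype.card_fin] at h1
    omega
  · intro T hT
    let B : Finset (Finset (Fin (q ^ 2 + 1))) := Finset.univ.filter (· ∈ circles C)
    have hB : ∀ b, b ∈ B ↔ b ∈ circles C := fun b => by simp [B]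
    rw [← card_blocks_disjoint (B := B) hq (Fintype.card_fin _)
      (fun b hb => card_of_mem_circles ((hB b).mp hb)) ?_ hT]
    · rw [← Set.ncard_coe_finset, ← Set.ncard_image_of_injective _
        (compl_injective (α := Finset (Fin (q ^ 2 + 1))))]
      congr 1
      ext b
      simp only [Set.mem_image, Set.mem_ofPred_eq, Finset.coe_filter, hB,
        mem_supportBlocks_iff hq]
      constructor
      · rintro ⟨a, ⟨ha, hTa⟩, rfl⟩
        exact ⟨ha, Finset.disjoint_left.mpr fun x hx hx' => Finset.mem_compl.mp hx' (hTa hx)⟩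
      · rintro ⟨hb, hTb⟩
        exact ⟨bᶜ, ⟨by rwa [compl_compl], fun x hx =>
          Finset.mem_compl.mpr (Finset.disjoint_left.mp hTb hx)⟩, compl_compl b⟩
    · intro S hS
      obtain ⟨b₀, hb₀⟩ := h.exists_unique_circle hq hS
      rw [Finset.card_eq_one]
      refine ⟨b₀, ?_⟩
      ext b
      rw [Finset.mem_filter, hB, Finset.mem_singleton]
      exact hb₀ b

/-! ### Words of weight four in the dual code. -/

lemma support_mem_iff {n : ℕ} {y : Fin n → K} {i : Fin n} : i ∈ support y ↔ y i ≠ 0 := by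
  simp [support]

lemma card_support {n : ℕ} (y : Fin n → K) : (support y).card = hammingNorm y := rfl

/-- On a support of at most three positions some codeword is nonzero at exactly one of them, so its
product with `y` would not be zero. -/
lemma four_le_hammingNorm_of_mem_dualCode (h : IsCircleCode q C) (hq : 3 ≤ q)
    {y : Fin (q ^ 2 + 1) → K} (hy : y ∈ dualCode C) (hy0 : y ≠ 0) : 4 ≤ hammingNorm y := by
  by_contra! hlt
  rw [← card_support] at hlt
  obtain ⟨i, hi⟩ := Function.ne_iff.mp hy0
  obtain ⟨w, hw, hwi, hwj⟩ := h.separates_finset hq (S := support y) (by omega) i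
    (support_mem_iff.mpr hi)
  have h1 : ∑ j, w j * y j = 0 := hy w hw
  rw [Finset.sum_eq_single i] at h1
  · exact mul_ne_zero hwi hi h1
  · intro j _ hji
    by_cases hj : y j = 0
    · rw [hj, mul_zero]
    · rw [hwj j (support_mem_iff.mpr hj) hji, zero_mul]
  · simp

/-- Four points of a circle support a codeword of the dual code. -/
lemma exists_mem_dualCode_support_eq (h : IsCircleCode q C) (hq : 3 ≤ q)
    {w : Fin (q ^ 2 + 1) → K} (hw : w ∈ C) (hw0 : w ≠ 0) {U : Finset (Fin (q ^ 2 + 1))}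
    (hU : U.card = 4) (hUw : U ⊆ zeros w) : ∃ y ∈ dualCode C, support y = U := by
  classical
  set f := (LinearMap.funLeft K K (Subtype.val : U → Fin (q ^ 2 + 1))).comp C.subtype
  -- Restriction to `U` kills `w`, so `C`, of dimension four, cannot fill `U → K`. A functional
  -- vanishing on the image is a dual word supported in `U`; the minimum distance then forces full
  -- support.
  have hrange : LinearMap.range f < ⊤ := by
    rw [lt_top_iff_ne_top]
    intro htop
    have h1 := LinearMap.finrank_range_add_finrank_ker f
    rw [htop, finrank_top, Module.finrank_fintype_fun_eq_card, Fintype.card_coe, hU,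
      h.finrank_eq hq] at h1
    have h2 : LinearMap.ker f = ⊥ := Submodule.finrank_eq_zero.mp (by omega)
    have h3 : (⟨w, hw⟩ : C) ∈ LinearMap.ker f := by
      rw [LinearMap.mem_ker]
      ext ⟨i, hi⟩
      exact mem_zeros.mp (hUw hi)
    rw [h2, Submodule.mem_bot] at h3
    exact hw0 (congrArg Subtype.val h3)
  obtain ⟨φ, hφ0, hφ⟩ := Submodule.exists_le_ker_of_lt_top _ hrange
  let y : Fin (q ^ 2 + 1) → K := fun i => if hi : i ∈ U then φ (Pi.single ⟨i, hi⟩ 1) else 0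
  have hφy : ∀ g : U → K, φ g = ∑ i : U, g i * y i := by
    intro g
    conv_lhs => rw [← Finset.univ_sum_single g, map_sum]
    refine Finset.sum_congr rfl fun i _ => ?_
    have : (Pi.single i (g i) : U → K) = g i • Pi.single i 1 := by
      rw [← Pi.single_smul, smul_eq_mul, mul_one]
    rw [this, map_smul, smul_eq_mul]
    simp [y]
  have hy0 : y ≠ 0 := by
    intro h0
    apply hφ0
    refine LinearMap.ext fun g => ?_
    simp [hφy, h0]
  have hsub : support y ⊆ U := by
    intro i hi
    by_contra hiU
    exact support_mem_iff.mp hi (by simp [y, hiU])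
  have hyC : y ∈ dualCode C := by
    intro x hx
    have h1 : φ (f ⟨x, hx⟩) = 0 := LinearMap.mem_ker.mp (hφ ⟨_, rfl⟩)
    rw [hφy] at h1
    rw [← Finset.sum_subset (Finset.subset_univ U) (fun i _ hi => by simp [y, hi]),
      ← Finset.sum_coe_sort]
    exact h1
  refine ⟨y, hyC, Finset.eq_of_subset_of_card_le hsub ?_⟩
  rw [hU, card_support]
  exact h.four_le_hammingNorm_of_mem_dualCode hq hyC hy0

/-- Take the circle through three of the four support points: orthogonality to its word forces that
word to vanish at the fourth as well. -/
lemma supportBlocks_dualCode (h : IsCircleCode q C) (hq : 3 ≤ q) :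
    supportBlocks (dualCode C) 4 = {U | U.card = 4 ∧ ∃ b ∈ circles C, U ⊆ b} := by
  ext U
  simp only [supportBlocks, Set.mem_ofPred_eq]
  constructor
  · rintro ⟨y, hy, hy4, rfl⟩
    refine ⟨hy4, ?_⟩
    obtain ⟨i, hi⟩ : (support y).Nonempty := by
      rw [← Finset.card_pos, card_support]; omega
    obtain ⟨w, hw, hTw, hwz⟩ := h.exists_circle_finset (T := (support y).erase i)
      (by rw [Finset.card_erase_of_mem hi, card_support, hy4])
    refine ⟨zeros w, ⟨w, hw, hwz, rfl⟩, ?_⟩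
    have h1 : ∑ j, w j * y j = 0 := hy w hw
    rw [Finset.sum_eq_single i] at h1
    · have hwi := (mul_eq_zero.mp h1).resolve_right (support_mem_iff.mp hi)
      intro j hj
      by_cases hji : j = i
      · subst hji; simpa
      · exact hTw (Finset.mem_erase.mpr ⟨hji, hj⟩)
    · intro j _ hji
      by_cases hj : y j = 0
      · rw [hj, mul_zero]
      · rw [mem_zeros.mp (hTw (Finset.mem_erase.mpr ⟨hji, support_mem_iff.mpr hj⟩)), zero_mul]
    · simp
  · rintro ⟨hU, _, ⟨w, hw, hwz, rfl⟩, hUw⟩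
    obtain ⟨y, hy, rfl⟩ := h.exists_mem_dualCode_support_eq hq hw
      (ne_zero_of_card_zeros hq hwz.le) hU hUw
    exact ⟨y, hy, hU, rfl⟩

lemma exists_mem_dualCode_hammingNorm (h : IsCircleCode q C) (hq : 3 ≤ q) :
    ∃ y ∈ dualCode C, y ≠ 0 ∧ hammingNorm y = 4 := by
  obtain ⟨w, hw, hwz⟩ := h.exists_circle_word hq
  obtain ⟨U, hUw, hU⟩ := Finset.exists_subset_card_eq (s := zeros w) (n := 4) (by omega)
  obtain ⟨y, hy, rfl⟩ := h.exists_mem_dualCode_support_eq hq hw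
    (ne_zero_of_card_zeros hq hwz.le) hU hUw
  rw [card_support] at hU
  exact ⟨y, hy, fun h0 => by simp [h0] at hU, hU⟩

theorem hasParameters_dualCode (h : IsCircleCode q C) (hq : 3 ≤ q) :
    HasParameters (dualCode C) (q ^ 2 - 3) 4 := by
  refine ⟨?_, isLeast_hammingDist_of_isLeast
    (fun y hy hy0 => h.four_le_hammingNorm_of_mem_dualCode hq hy hy0)
    (h.exists_mem_dualCode_hammingNorm hq)⟩
  rw [finrank_dualCode, h.finrank_eq hq]
  omega

/-- A block through `T` lies on the unique circle through `T`, so it is `T` with one of the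
remaining `q + 1 - 3` points of that circle. -/
theorem supportsDesign_dualCode [Finite K] (h : IsCircleCode q C) (hq : 3 ≤ q) :
    SupportsDesign (dualCode C) 3 4 (q - 2) := by
  classical
  have hqq : q * 3 ≤ q ^ 2 := by rw [sq]; exact Nat.mul_le_mul_left q hq
  refine ⟨by omega, by omega, ?_, Fintype.card_fin _, by omega, by omega, ?_, ?_⟩
  · obtain ⟨y, hy, -, hy4⟩ := h.exists_mem_dualCode_hammingNorm hq
    rw [weightCount]
    exact Set.ncard_ne_zero_of_mem (a := y) ⟨hy, hy4⟩ (Set.toFinite _)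
  · rw [h.supportBlocks_dualCode hq]
    exact fun U hU => hU.1
  · intro T hT
    obtain ⟨b₀, hb₀⟩ := h.exists_unique_circle hq hT
    obtain ⟨hbC, hTb⟩ := (hb₀ b₀).mpr rfl
    have hset : {U | U ∈ supportBlocks (dualCode C) 4 ∧ T ⊆ U} =
        ((b₀ \ T).image fun i => insert i T : Finset (Finset (Fin (q ^ 2 + 1)))) := by
      ext U
      rw [h.supportBlocks_dualCode hq]
      simp only [Set.mem_ofPred_eq, Finset.coe_image, Set.mem_image, Finset.mem_coe,
        Finset.mem_sdiff]
      constructor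
      · rintro ⟨⟨hU, b, hb, hUb⟩, hTU⟩
        obtain rfl := (hb₀ b).mp ⟨hb, hTU.trans hUb⟩
        obtain ⟨i, hi⟩ := Finset.card_eq_one.mp
          (show (U \ T).card = 1 by rw [Finset.card_sdiff_of_subset hTU]; omega)
        have hiU : i ∈ U \ T := by simp [hi]
        rw [Finset.mem_sdiff] at hiU
        refine ⟨i, ⟨hUb hiU.1, hiU.2⟩, ?_⟩
        rw [Finset.insert_eq, ← hi, Finset.sdiff_union_of_subset hTU]
      · rintro ⟨i, ⟨hib, hiT⟩, rfl⟩
        exact ⟨⟨by rw [Finset.card_insert_of_notMem hiT, hT], b₀, hbC,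
          Finset.insert_subset hib hTb⟩, Finset.subset_insert _ _⟩
    rw [hset, Set.ncard_coe_finset, Finset.card_image_of_injOn, Finset.card_sdiff_of_subset hTb,
      card_of_mem_circles hbC, hT]
    · omega
    · intro i hi j hj hij
      have hi' := (Finset.mem_sdiff.mp hi).2
      have : i ∈ insert j T := by
        have h1 : insert i T = insert j T := hij
        rw [← h1]; exact Finset.mem_insert_self i T
      exact (Finset.mem_insert.mp this).resolve_right hi'

end IsCircleCode

end ConstacyclicCodes

end

theorem theorem4 (q : ℕ) (hq : IsPrimePow q) (hq4 : q ≡ 3 [MOD 4])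
    (K : Type*) [Field K] [DecidableEq K] (hK : Nat.card K = q ^ 2)
    (L : Type*) [Field L] [Algebra K L] (hL : Nat.card L = q ^ 4)
    (δ : L) (hδ : IsPrimitiveRoot δ (2 * (q ^ 2 + 1))) :
    -- the code is well defined: its check polynomial divides `x ^ (q ^ 2 + 1) + 1`
    ConstacyclicCodes.checkPoly q K δ ∣ X ^ (q ^ 2 + 1) - Polynomial.C (-1 : K) ∧
    ConstacyclicCodes.IsNegacyclic (ConstacyclicCodes.negacyclicCode q K δ) ∧
    -- parameters and weight enumerator of the code
    ConstacyclicCodes.HasParameters (ConstacyclicCodes.negacyclicCode q K δ) 4 (q ^ 2 - q) ∧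
    ConstacyclicCodes.weightEnumerator (ConstacyclicCodes.negacyclicCode q K δ) =
      1 + Polynomial.C ((q : ℚ) ^ 5 - q) * X ^ (q ^ 2 - q)
        + Polynomial.C ((((q : ℚ) ^ 4 - 1) * ((q : ℚ) - 1) * (q : ℚ) ^ 3) / 2)
          * (X ^ (q ^ 2 - 1) + X ^ (q ^ 2 + 1))
        + Polynomial.C ((q : ℚ) ^ 7 - (q : ℚ) ^ 5 + (q : ℚ) ^ 4 - (q : ℚ) ^ 3 + (q : ℚ) - 1)
          * X ^ (q ^ 2) ∧
    -- the design held by its minimum weight codewords, and the complementary design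
    ConstacyclicCodes.SupportsDesign (ConstacyclicCodes.negacyclicCode q K δ) 3 (q ^ 2 - q)
      ((q ^ 2 - q - 1) * (q - 2)) ∧
    ConstacyclicCodes.IsSteinerSystem 3 (q + 1) (q ^ 2 + 1)
      (ConstacyclicCodes.complementBlocks
        (ConstacyclicCodes.supportBlocks (ConstacyclicCodes.negacyclicCode q K δ) (q ^ 2 - q))) ∧
    -- the dual code and the design held by its minimum weight codewords
    ConstacyclicCodes.HasParameters
      (ConstacyclicCodes.dualCode (ConstacyclicCodes.negacyclicCode q K δ)) (q ^ 2 - 3) 4 ∧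
    ConstacyclicCodes.SupportsDesign
      (ConstacyclicCodes.dualCode (ConstacyclicCodes.negacyclicCode q K δ)) 3 4 (q - 2) := by
  have hq4' : q % 4 = 3 := hq4
  have hq3 : 3 ≤ q := by omega
  have : Finite K := Nat.finite_of_card_ne_zero (by rw [hK]; positivity)
  have := Fintype.ofFinite K
  have hKF : Fintype.card K = q ^ 2 := by rw [← Nat.card_eq_fintype_card, hK]
  have hdvd := ConstacyclicCodes.checkPoly_dvd hq3 hq4' hK hL hδ
  have h := ConstacyclicCodes.isCircleCode_negacyclicCode hq hq4' hK hL hδ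
  exact ⟨hdvd, ConstacyclicCodes.isConstacyclic_codeOfCheck (Nat.succ_ne_zero _) hdvd,
    h.hasParameters hq3, h.weightEnumerator_eq hq3 hKF, h.supportsDesign hq3,
    h.isSteinerSystem hq3, h.hasParameters_dualCode hq3, h.supportsDesign_dualCode hq3⟩
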